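/- Let $\ell\ge 2$ and let $\vec s=(a_1,\dots,a_\ell)$ be a fixed vector of natural numbers with $a_1\ge a_2\ge\cdots\ge a_\ell\ge 0$ and $a_2=\cdots=a_\ell$. A top-$\ell$ vote on a finite set $M$ of candidates is a linear order on an $\ell$-element subset of $M$; it gives $a_j$ points to the candidate in its $j$-th position and $0$ points to every unranked candidate. The score of a candidate in a profile (a finite list of votes) is the sum of its points over all votes, and the winner of the profile is the candidate with the maximum score, ties being broken by a given priority order on $M$. Consider the following decision problem (winner with absent votes, WAV). Input: a finite set $M$ of candidates listed in the order of their tie-breaking priority, a profile $P$ of known top-$\ell$ votes on $M$, the number $t\ge 0$ of absent votes (written in binary), and a candidate $c\in M$. Question: is there a profile $P'$ of $t$ top-$\ell$ votes on $M$ such that $c$ is the winner of the joint profile $P\cup P'$? This problem is decidable by a deterministic Turing machine in time polynomial in the length of the input. -/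

import Mathlib

/-! Winner with absent votes under positional scoring rules on top-`ℓ` votes. -/

namespace WAV

/-- A top-`ℓ` ranking of the candidates `Fin m`: an `ℓ`-subset of the candidates together with a
linear order on it, given as the injective map sending a position (`0` is the top) to the
candidate ranked there. -/
abbrev TopRanking (ℓ m : ℕ) : Type := Fin ℓ ↪ Fin m

/-- The score that candidate `x` gets from one vote: `a j` if `x` is ranked in position `j`,
and `0` if `x` is not ranked. -/
def voteScore {ℓ m : ℕ} (a : Fin ℓ → ℕ) (v : TopRanking ℓ m) (x : Fin m) : ℕ :=
  ∑ j : Fin ℓ, if v j = x then a j else 0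

/-- The total score of candidate `x` in a profile. -/
def score {ℓ m : ℕ} (a : Fin ℓ → ℕ) (P : List (TopRanking ℓ m)) (x : Fin m) : ℕ :=
  (P.map fun v => voteScore a v x).sum

/-- `c` is the winner of the positional scoring rule with scoring vector `a` on the profile `P`:
it has the maximum score, and it comes first in the tie-breaking priority among all candidates
with the maximum score. Here `prio i` is the candidate with the `i`-th highest priority. -/
def IsWinner {ℓ m : ℕ} (a : Fin ℓ → ℕ) (prio : Fin m ≃ Fin m) (P : List (TopRanking ℓ m))
    (c : Fin m) : Prop :=
  (∀ x, score a P x ≤ score a P c) ∧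
    ∀ x, score a P x = score a P c → prio.symm c ≤ prio.symm x

/-- The rule is resolute: every profile has exactly one winner. -/
theorem existsUnique_isWinner {ℓ m : ℕ} (hm : 0 < m) (a : Fin ℓ → ℕ) (prio : Fin m ≃ Fin m)
    (P : List (TopRanking ℓ m)) : ∃! c, IsWinner a prio P c := by
  have : Nonempty (Fin m) := ⟨⟨0, hm⟩⟩
  obtain ⟨y, hy⟩ := Finite.exists_max (score a P)
  obtain ⟨c, hc, hmin⟩ := Finset.exists_min_image
    (Finset.univ.filter fun x => score a P x = score a P y) prio.symm ⟨y, by simp⟩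
  simp only [Finset.mem_filter, Finset.mem_univ, true_and] at hc hmin
  refine ⟨c, ⟨fun x => hc ▸ hy x, fun x hx => hmin x (hx.trans hc)⟩, fun d hd => ?_⟩
  have hdc : score a P d = score a P c := le_antisymm (hc ▸ hy d) (hd.1 c)
  exact prio.symm.injective (le_antisymm (hd.2 c hdc.symm) (hmin d (hdc.trans hc)))

/-- An instance of the problem: the candidates `Fin m`, the tie-breaking priority among them,
the profile of known votes, the number `t` of absent votes, and the target candidate. -/
structure Instance (ℓ : ℕ) where
  /-- the number of candidates -/
  m : ℕ
  /-- `prio i` is the candidate with the `i`-th highest priority in tie-breaking -/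
  prio : Fin m ≃ Fin m
  /-- the known votes -/
  known : List (TopRanking ℓ m)
  /-- the number of absent votes -/
  t : ℕ
  /-- the target candidate -/
  target : Fin m

/-- The YES instances: there is a profile of `t` further votes which, joined to the known votes,
makes the target candidate the winner. -/
def IsYes {ℓ : ℕ} (a : Fin ℓ → ℕ) (I : Instance ℓ) : Prop :=
  ∃ P' : List (TopRanking ℓ I.m),
    P'.length = I.t ∧ IsWinner a I.prio (I.known ++ P') I.target

/-- The input alphabet: binary digits and two separators. -/
inductive Sym : Type
  | bit (b : Bool) : Sym
  | comma : Sym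
  | semi : Sym
  deriving DecidableEq, Fintype

/-- A natural number in binary, terminated by a comma. -/
def encodeNum (n : ℕ) : List Sym :=
  (Computability.encodeNat n).map Sym.bit ++ [Sym.comma]

/-- A list of natural numbers in binary, terminated by a semicolon. -/
def encodeNums (l : List ℕ) : List Sym :=
  l.flatMap encodeNum ++ [Sym.semi]

/-- The input string of an instance: the target candidate, the number of absent votes in binary,
the list of all candidates in order of priority, and the list of the known votes, each being the
list of its candidates from the top position down. -/
def encode {ℓ : ℕ} (I : Instance ℓ) : List Sym :=
  encodeNum I.target ++ encodeNum I.t ++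
    encodeNums (List.ofFn fun i => (I.prio i : ℕ)) ++
    I.known.flatMap fun v => encodeNums (List.ofFn fun j => (v j : ℕ))

theorem encodeNum_append_inj {n k : ℕ} {u v : List Sym}
    (h : encodeNum n ++ u = encodeNum k ++ v) : n = k ∧ u = v := by
  have key : ∀ (xs ys : List Bool), xs.map Sym.bit ++ Sym.comma :: u =
      ys.map Sym.bit ++ Sym.comma :: v → xs = ys ∧ u = v := by
    intro xs
    induction xs with
    | nil => intro ys h; cases ys <;> simp_all
    | cons x xs ih =>
      intro ys h
      cases ys with
      | nil => simp at h
      | cons y ys =>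
        simp only [List.map_cons, List.cons_append, List.cons.injEq, Sym.bit.injEq] at h
        obtain ⟨h1, h2⟩ := ih ys h.2
        exact ⟨by rw [h.1, h1], h2⟩
  obtain ⟨h1, h2⟩ := key _ _ (by simpa [encodeNum] using h)
  refine ⟨?_, h2⟩
  rw [← Computability.decode_encodeNat n, h1, Computability.decode_encodeNat]

theorem encodeNums_append_inj {l k : List ℕ} {u v : List Sym}
    (h : encodeNums l ++ u = encodeNums k ++ v) : l = k ∧ u = v := by
  have hne : ∀ (n : ℕ) (w w' : List Sym), Sym.semi :: w ≠ encodeNum n ++ w' := by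
    intro n w w' h
    unfold encodeNum at h
    cases hb : Computability.encodeNat n <;> simp [hb] at h
  induction l generalizing k with
  | nil =>
    cases k with
    | nil => simpa [encodeNums] using h
    | cons y ys => exact absurd (by simpa [encodeNums] using h) (hne y u _)
  | cons x xs ih =>
    cases k with
    | nil => exact absurd (by simpa [encodeNums] using h.symm) (hne x v _)
    | cons y ys =>
      have h' : encodeNum x ++ (encodeNums xs ++ u) = encodeNum y ++ (encodeNums ys ++ v) := by
        simpa [encodeNums] using h
      obtain ⟨h1, h2⟩ := encodeNum_append_inj h'
      obtain ⟨h3, h4⟩ := ih h2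
      exact ⟨by rw [h1, h3], h4⟩

/-- Different instances have different input strings. -/
theorem encode_injective (ℓ : ℕ) : Function.Injective (encode (ℓ := ℓ)) := by
  rintro ⟨m, p, P, t, c⟩ ⟨m', p', P', t', c'⟩ h
  simp only [encode, List.append_assoc] at h
  obtain ⟨hc, h⟩ := encodeNum_append_inj h
  obtain ⟨ht, h⟩ := encodeNum_append_inj h
  obtain ⟨hp, h⟩ := encodeNums_append_inj h
  have hm : m = m' := by simpa using congrArg List.length hp
  subst hm
  have hc' : c = c' := Fin.ext hc
  have hp' : p = p' := by
    ext i
    exact congrFun (List.ofFn_injective hp) i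
  subst ht hc' hp'
  have key : ∀ Q Q' : List (TopRanking ℓ m),
      (Q.flatMap fun v => encodeNums (List.ofFn fun j => (v j : ℕ))) =
        (Q'.flatMap fun v => encodeNums (List.ofFn fun j => (v j : ℕ))) → Q = Q' := by
    intro Q
    induction Q with
    | nil =>
      intro Q' h
      cases Q' with
      | nil => rfl
      | cons w Q' => exact absurd h (by simp [encodeNums])
    | cons v Q ih =>
      intro Q' h
      cases Q' with
      | nil => exact absurd h (by simp [encodeNums])
      | cons w Q' =>
        simp only [List.flatMap_cons] at h
        obtain ⟨h1, h2⟩ := encodeNums_append_inj h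
        have hvw : v = w := by
          ext i
          exact congrFun (List.ofFn_injective h1) i
        rw [hvw, ih Q' h2]
  have hP : P = P' := key P P' h
  subst hP
  rfl

open Classical in
/-- The decision problem `L` on inputs of type `α`, written as strings by `enc`, is decided by a
deterministic Turing machine (with finitely many states, labels and stacks, and finite stack
alphabets) in time polynomial in the length of the input string. -/
def DecidableInPolyTime {α Γ : Type} (enc : α → List Γ) (L : α → Prop) : Prop :=
  ∃ M : Turing.TM2ComputableInPolyTime enc Computability.encodeBool (fun x => decide (L x)),
    ∀ k, Finite (M.tm.Γ k)

end WAV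

/-! Let `b` be the common tail value of the scoring vector, `a 0 = b + d`, and `s` the known scores.
With `t` absent votes the target `c` ends with at most `s c + t * (b + d)` points, and with exactly
that if it is on top of each of them. Another candidate `x` appearing in `u` absent votes gains at
least `b * u` points, and exactly that if it is never on top. So `c` can stay ahead of `x` only if
`b * u + e ≤ b * t`, where the excess `e` is the amount by which `s x`, plus one if `x` precedes `c`
in the priority order, surpasses `s c + t * d`. For `b > 0` the largest admissible `u` is `t - ⌈e /
b⌉`, the capacity of `x`; the capacity of `c` is `t`. The absent votes have `t * ℓ` positions, so a
YES instance needs every excess to be at most `b * t` and the capacities to add up to at least `t *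
ℓ`. Conversely, any appearance counts that are at most `t` each and `t * (ℓ - 1)` in total are
realised below `c` by greedy choice (`exists_votes`). This gives the criterion `isYes_iff`.

As `t` is written in binary, it may be exponential in the input length. Beyond any `N ≥ ∑ (s x +
1)`, however, the criterion no longer depends on `t` (`feasible_min_iff`), so `t` may be cut off at
a constant multiple of the input length. All arithmetic can then be done in unary by loops over
stacks. Such programs compile to multi-stack machines step for step (`Runs.reachesIn`), and the
decision program runs in cubic time (`exec_decideProg`). -/

namespace StackProgram

/-! ### Structured stack programs and their compilation to Turing machines -/

open Turing Function

/-- Structured programs on finitely many stacks `K` with a common alphabet `A`. -/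
inductive Prog (K A : Type) : Type
  /-- do nothing -/
  | skip : Prog K A
  /-- push a symbol -/
  | push (k : K) (a : A) : Prog K A
  /-- sequential composition -/
  | seq (p q : Prog K A) : Prog K A
  /-- pop symbols from a stack and run the body on them, until the stack is empty or a end symbol
  has been popped -/
  | loop (k : K) (isEnd : A → Bool) (body : A → Prog K A) : Prog K A
  /-- pop a symbol, if there is one, and branch on the result -/
  | popCase (k : K) (body : Option A → Prog K A) : Prog K A

infixr:60 " ;; " => Prog.seq

namespace Prog

variable {K A : Type}

/-- `Runs p s s' n`: the program `p` takes the stacks `s` to the stacks `s'` within `n` steps. -/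
inductive Runs [DecidableEq K] : Prog K A → (K → List A) → (K → List A) → ℕ → Prop
  | skip (s) : Runs skip s s 1
  | push (k a s) : Runs (push k a) s (update s k (a :: s k)) 1
  | seq {p q s s' s'' n m} : Runs p s s' n → Runs q s' s'' m → Runs (p ;; q) s s'' (n + m)
  | loop_nil {k isEnd body s} : s k = [] → Runs (loop k isEnd body) s s 1
  | loop_end {k isEnd body s a l} : s k = a :: l → isEnd a = true →
      Runs (loop k isEnd body) s (update s k l) 1
  | loop_cons {k isEnd body s a l s' s'' n m} : s k = a :: l → isEnd a = false →
      Runs (body a) (update s k l) s' n → Runs (loop k isEnd body) s' s'' m →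
      Runs (loop k isEnd body) s s'' (n + m + 1)
  | popCase {k body s s' n} : Runs (body (s k).head?) (update s k (s k).tail) s' n →
      Runs (popCase k body) s s' (n + 1)
  | mono {p s s' n m} : Runs p s s' n → n ≤ m → Runs p s s' m

/-- The control points of a program. -/
def Label : Prog K A → Type
  | skip => Unit
  | push _ _ => Unit
  | seq p q => Label p ⊕ Label q
  | loop _ _ body => Option (Σ a, Label (body a))
  | popCase _ body => Option (Σ o, Label (body o))

instance finite_label [Finite A] : ∀ p : Prog K A, Finite (Label p)
  | skip => inferInstanceAs (Finite Unit)
  | push _ _ => inferInstanceAs (Finite Unit)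
  | seq p q =>
    have := finite_label p
    have := finite_label q
    inferInstanceAs (Finite (Label p ⊕ Label q))
  | loop _ _ body =>
    have := fun a => finite_label (body a)
    inferInstanceAs (Finite (Option (Σ a, Label (body a))))
  | popCase _ body =>
    have := fun a => finite_label (body a)
    inferInstanceAs (Finite (Option (Σ o, Label (body o))))

/-- The control point at which a program starts. -/
def entry : (p : Prog K A) → Label p
  | skip => ()
  | push _ _ => ()
  | seq p _ => Sum.inl (entry p)
  | loop _ _ _ => none
  | popCase _ _ => none

/-- The stack alphabets of the compiled machine: there is an additional stack for the answer. -/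
abbrev Alphabet (K A : Type) : Option K → Type
  | none => Bool
  | some _ => A

/-- The statement at a control point of a program that is embedded by `ι` into a machine with
labels `Λ` and is left to the label `exit`. -/
def compile {Λ : Type} : (p : Prog K A) → (Label p → Λ) → Λ → Label p →
    TM2.Stmt (Alphabet K A) Λ (Option A)
  | skip, _, exit, _ => .goto fun _ => exit
  | push k a, _, exit, _ => .push (some k) (fun _ => a) (.goto fun _ => exit)
  | seq p _, ι, _, .inl l => compile p (ι ∘ Sum.inl) (ι (Sum.inr (entry _))) l
  | seq _ q, ι, exit, .inr l => compile q (ι ∘ Sum.inr) exit l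
  | loop k isEnd body, ι, exit, none =>
    .pop (some k) (fun _ o => o) (.goto fun o =>
      match o with
      | none => exit
      | some a => bif isEnd a then exit else ι (some ⟨a, entry (body a)⟩))
  | loop _ _ body, ι, _, some ⟨a, l⟩ => compile (body a) (fun l => ι (some ⟨a, l⟩)) (ι none) l
  | popCase k body, ι, _, none =>
    .pop (some k) (fun _ o => o) (.goto fun o => ι (some ⟨o, entry (body o)⟩))
  | popCase _ body, ι, exit, some ⟨o, l⟩ =>
    compile (body o) (fun l => ι (some ⟨o, l⟩)) exit l

variable [DecidableEq K]

/-- The stacks of the compiled machine, with an empty answer stack. -/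
def extend (s : K → List A) : ∀ k : Option K, List (Alphabet K A k)
  | none => []
  | some k => s k

theorem extend_update (s : K → List A) (k : K) (l : List A) :
    extend (update s k l) = update (extend s) (some k) l := by
  funext k'
  cases k' with
  | none => simp [extend]
  | some k' =>
    by_cases h : k' = k
    · subst h; simp [extend]
    · have h' : (some k' : Option K) ≠ some k := by simpa using h
      rw [update_of_ne h']
      simp [extend, update_of_ne h]

/-- The configuration `c'` is reached from `c` within `n` steps. -/
def ReachesIn {Λ : Type} (M : Λ → TM2.Stmt (Alphabet K A) Λ (Option A))
    (c c' : TM2.Cfg (Alphabet K A) Λ (Option A)) (n : ℕ) : Prop :=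
  ∃ k ≤ n, (flip bind (TM2.step M))^[k] (some c) = some c'

theorem ReachesIn.trans {Λ : Type} {M : Λ → TM2.Stmt (Alphabet K A) Λ (Option A)}
    {c c' c'' : TM2.Cfg (Alphabet K A) Λ (Option A)} {n m : ℕ}
    (h : ReachesIn M c c' n) (h' : ReachesIn M c' c'' m) : ReachesIn M c c'' (n + m) := by
  obtain ⟨k, hk, e⟩ := h
  obtain ⟨k', hk', e'⟩ := h'
  exact ⟨k' + k, by omega, by rw [iterate_add_apply, e, e']⟩

theorem ReachesIn.single {Λ : Type} {M : Λ → TM2.Stmt (Alphabet K A) Λ (Option A)}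
    {c c' : TM2.Cfg (Alphabet K A) Λ (Option A)} (h : TM2.step M c = some c') :
    ReachesIn M c c' 1 :=
  ⟨1, le_rfl, by simpa [flip] using h⟩

/-- Induction on the run. The embedding `ι` and the exit stay general because a subprogram is
compiled into the labels of the whole, with its continuation as exit. The register `v` may be
arbitrary at entry: it is consulted only right after a pop has overwritten it. -/
theorem Runs.reachesIn {p : Prog K A} {s s' : K → List A} {n : ℕ} (h : Runs p s s' n)
    {Λ : Type} (M : Λ → TM2.Stmt (Alphabet K A) Λ (Option A)) (ι : Label p → Λ) (exit : Λ)
    (hM : ∀ l, M (ι l) = compile p ι exit l) (v : Option A) :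
    ∃ v', ReachesIn M ⟨some (ι (entry p)), v, extend s⟩ ⟨some exit, v', extend s'⟩ n := by
  induction h generalizing exit v with
  | skip s =>
    exact ⟨v, .single (by simp [hM, compile])⟩
  | push k a s =>
    exact ⟨v, .single (by simp [hM, compile, extend_update]; rfl)⟩
  | @seq p q _ _ _ _ _ _ _ ih₁ ih₂ =>
    obtain ⟨v', h₁⟩ := ih₁ (ι ∘ Sum.inl) (ι (Sum.inr (entry q))) (fun l => hM (Sum.inl l)) v
    obtain ⟨v'', h₂⟩ := ih₂ (ι ∘ Sum.inr) exit (fun l => hM (Sum.inr l)) v'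
    exact ⟨v'', h₁.trans h₂⟩
  | @loop_nil k isEnd body s h =>
    refine ⟨none, .single ?_⟩
    have : (extend s (some k)) = [] := h
    have e : update (extend s) (some k) ([] : List A) = extend s := by
      rw [← extend_update, ← h, update_eq_self]
    have h₀ : M (ι none) = _ := hM none
    simp only [compile] at h₀
    simp [entry, h₀, this, e]
  | @loop_end k isEnd body s a l h hs =>
    refine ⟨some a, .single ?_⟩
    have : (extend s (some k)) = a :: l := h
    have h₀ : M (ι none) = _ := hM none
    simp only [compile] at h₀
    simp [entry, h₀, this, hs, extend_update]
  | @loop_cons k isEnd body s a l s' s'' n m h hs _ _ ih₁ ih₂ =>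
    obtain ⟨v', h₁⟩ := ih₁ (fun l => ι (some ⟨a, l⟩)) (ι none) (fun l => hM (some ⟨a, l⟩)) (some a)
    obtain ⟨v'', h₂⟩ := ih₂ ι exit hM v'
    refine ⟨v'', ?_⟩
    have this : (extend s (some k)) = a :: l := h
    have hM' : M (ι none) = _ := hM none
    simp only [compile] at hM'
    -- The pop is a single step into the body; the exit of the body is the loop head `ι none`, where
    -- the remaining iterations start.
    have h₀ : ReachesIn M ⟨some (ι none), v, extend s⟩
        ⟨some (ι (some ⟨a, entry (body a)⟩)), some a, extend (update s k l)⟩ 1 :=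
      .single (by simp [hM', this, hs, extend_update])
    have := (h₀.trans h₁).trans h₂
    rwa [show 1 + n + m = n + m + 1 by omega] at this
  | @popCase k body s s' n _ ih =>
    obtain ⟨v', h₁⟩ := ih (fun l => ι (some ⟨_, l⟩)) exit (fun l => hM (some ⟨_, l⟩)) (s k).head?
    refine ⟨v', ?_⟩
    have hM' : M (ι none) = _ := hM none
    simp only [compile] at hM'
    have h₀ : ReachesIn M ⟨some (ι none), v, extend s⟩
        ⟨some (ι (some ⟨(s k).head?, entry (body (s k).head?)⟩)), (s k).head?,
          extend (update s k (s k).tail)⟩ 1 :=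
      .single (by simp [hM', extend_update]; exact ⟨rfl, rfl, rfl⟩)
    have := h₀.trans h₁
    rwa [add_comm] at this
  | mono _ hnm ih =>
    obtain ⟨v', k, hk, e⟩ := ih ι exit hM v
    exact ⟨v', k, hk.trans hnm, e⟩

/-- The machine of a program with input stack `k₀`, which at the end of the program moves the
answer from the stack `k₁` to the answer stack. -/
noncomputable def machine [Fintype K] [Fintype A] (k₀ k₁ : K) (isTrue : A → Bool) (p : Prog K A) :
    FinTM2 where
  K := Option K
  k₀ := some k₀
  k₁ := none
  Γ := Alphabet K A
  Λ := Option (Label p)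
  main := some (entry p)
  ΛFin := Fintype.ofFinite _
  σ := Option A
  initialState := none
  Γk₀Fin := inferInstanceAs (Fintype A)
  m
    | some l => compile p some none l
    | none => .pop (some k₁) (fun _ o => o)
        (.push none (fun o => o.any isTrue) (.load (fun _ => none) .halt))

/-- The additional step is the one at label `none`: it transfers the answer and resets the register,
since `haltList` requires the initial state and all stacks but the output empty. -/
theorem Runs.outputs [Fintype K] [Fintype A] {k₀ k₁ : K} {isTrue : A → Bool} {p : Prog K A}
    {x : List A} {a : A} {n : ℕ}
    (h : Runs p (update (fun _ => []) k₀ x) (update (fun _ => []) k₁ [a]) n) :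
    Nonempty (TM2OutputsInTime (machine k₀ k₁ isTrue p) x (some [isTrue a]) (n + 1)) := by
  obtain ⟨v, h₁⟩ := h.reachesIn (machine k₀ k₁ isTrue p).m some none (fun l => rfl) none
  have h₂ : ReachesIn (machine k₀ k₁ isTrue p).m
      ⟨some none, v, extend (update (fun _ => []) k₁ [a])⟩
      (haltList (machine k₀ k₁ isTrue p) [isTrue a]) 1 := by
    refine .single ?_
    simp only [machine, TM2.step, TM2.stepAux, haltList, Option.some.injEq]
    congr 1
    funext k
    rcases k with _ | k
    · simp [extend]
      rfl
    · by_cases hk : k = k₁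
      · subst hk
        simp [extend]
      · simp [extend, hk]
  obtain ⟨k, hk, e⟩ := h₁.trans h₂
  refine ⟨⟨⟨k, ?_⟩, hk⟩⟩
  have : initList (machine k₀ k₁ isTrue p) x =
      ⟨some (some (entry p)), none, extend (update (fun _ => []) k₀ x)⟩ := by
    simp only [initList, machine]
    congr 1
    funext k
    rcases k with _ | k
    · simp [extend]
    · by_cases hk : k = k₀
      · subst hk
        simp [extend]
        rfl
      · simp [extend, hk]
  rw [this]
  exact e

end Prog

open Prog in
/-- A problem is decidable in polynomial time if a program writes the answer within polynomially
many steps. -/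
theorem decidableInPolyTime_of_runs {α K A : Type} [DecidableEq K] [Fintype K] [Fintype A]
    {enc : α → List A} {L : α → Prop} (p : Prog K A) (k₀ k₁ : K) (isTrue : A → Bool)
    (time : Polynomial ℕ)
    (h : ∀ x, ∃ a, (isTrue a = true ↔ L x) ∧
      Runs p (update (fun _ => []) k₀ (enc x)) (update (fun _ => []) k₁ [a])
        (time.eval (enc x).length)) :
    WAV.DecidableInPolyTime enc L := by
  classical
  refine ⟨⟨⟨machine k₀ k₁ isTrue p, Equiv.refl _, Equiv.refl _⟩, time + 1, fun x => ?_⟩, ?_⟩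
  · refine Classical.choice ?_
    obtain ⟨a, ha, hr⟩ := h x
    have h₁ := hr.outputs (isTrue := isTrue)
    have e : @decide (L x) (Classical.propDecidable _) = isTrue a := by
      rw [Bool.eq_iff_iff, ha, decide_eq_true_iff]
    have e₁ : (time + 1).eval (enc x).length = time.eval (enc x).length + 1 := by simp
    have e₂ : List.map (Equiv.refl A).invFun (enc x) = enc x := List.map_id _
    rw [e₁]
    change Nonempty (TM2OutputsInTime (machine k₀ k₁ isTrue p)
      (List.map (Equiv.refl A).invFun (enc x)) (some [@decide (L x) (Classical.propDecidable _)]) _)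
    have key : ∀ y : List A, y = enc x → Nonempty (TM2OutputsInTime (machine k₀ k₁ isTrue p) y
        (some [isTrue a]) (time.eval (enc x).length + 1)) := by
      rintro y rfl
      exact h₁
    rw [e]
    exact key _ e₂
  · intro k
    rcases k with _ | k
    · exact inferInstanceAs (Finite Bool)
    · exact inferInstanceAs (Finite A)

end StackProgram

namespace WAV

/-! ### The numerical criterion for YES instances -/

open Finset

theorem voteScore_apply {ℓ m : ℕ} (a : Fin ℓ → ℕ) (v : TopRanking ℓ m) (j : Fin ℓ) :
    voteScore a v (v j) = a j := by
  simp [voteScore]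

theorem voteScore_eq_zero {ℓ m : ℕ} (a : Fin ℓ → ℕ) (v : TopRanking ℓ m) {x : Fin m}
    (h : ∀ j, v j ≠ x) : voteScore a v x = 0 := by
  simp [voteScore, h]

/-- The scoring vector `fun _ => 1` counts appearances, and each appearance is worth at least `b`.
-/
theorem mul_voteScore_one_le {ℓ m b : ℕ} {a : Fin ℓ → ℕ} (hb : ∀ j, b ≤ a j)
    (v : TopRanking ℓ m) (x : Fin m) : b * voteScore (fun _ => 1) v x ≤ voteScore a v x := by
  by_cases h : ∃ j, v j = x
  · obtain ⟨j, rfl⟩ := h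
    simpa [voteScore_apply] using hb j
  · push Not at h
    simp [voteScore_eq_zero _ v h]

theorem voteScore_le {ℓ m A : ℕ} {a : Fin ℓ → ℕ} (hA : ∀ j, a j ≤ A)
    (v : TopRanking ℓ m) (x : Fin m) : voteScore a v x ≤ A := by
  by_cases h : ∃ j, v j = x
  · obtain ⟨j, rfl⟩ := h
    simpa [voteScore_apply] using hA j
  · push Not at h
    simp [voteScore_eq_zero _ v h]

theorem sum_voteScore {ℓ m : ℕ} (a : Fin ℓ → ℕ) (v : TopRanking ℓ m) :
    ∑ x, voteScore a v x = ∑ j, a j := by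
  simp only [voteScore]
  rw [sum_comm]
  simp

theorem score_append {ℓ m : ℕ} (a : Fin ℓ → ℕ) (P Q : List (TopRanking ℓ m)) (x : Fin m) :
    score a (P ++ Q) x = score a P x + score a Q x := by
  simp [score]

theorem score_cons {ℓ m : ℕ} (a : Fin ℓ → ℕ) (v : TopRanking ℓ m) (P : List (TopRanking ℓ m))
    (x : Fin m) : score a (v :: P) x = voteScore a v x + score a P x := by
  simp [score]

theorem mul_score_one_le {ℓ m b : ℕ} {a : Fin ℓ → ℕ} (hb : ∀ j, b ≤ a j)
    (P : List (TopRanking ℓ m)) (x : Fin m) : b * score (fun _ => 1) P x ≤ score a P x := by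
  induction P with
  | nil => simp [score]
  | cons v P ih =>
    rw [score_cons, score_cons, mul_add]
    exact add_le_add (mul_voteScore_one_le hb v x) ih

theorem score_le {ℓ m A : ℕ} {a : Fin ℓ → ℕ} (hA : ∀ j, a j ≤ A)
    (P : List (TopRanking ℓ m)) (x : Fin m) : score a P x ≤ P.length * A := by
  induction P with
  | nil => simp [score]
  | cons v P ih =>
    rw [score_cons, List.length_cons, add_mul, one_mul, add_comm]
    exact add_le_add ih (voteScore_le hA v x)

theorem sum_score {ℓ m : ℕ} (a : Fin ℓ → ℕ) (P : List (TopRanking ℓ m)) :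
    ∑ x, score a P x = P.length * ∑ j, a j := by
  induction P with
  | nil => simp [score]
  | cons v P ih =>
    simp only [score_cons, sum_add_distrib, ih, sum_voteScore, List.length_cons]
    ring

/-- The handicap of candidate `x` against `c` in tie-breaking. -/
def tieBonus {m : ℕ} (prio : Fin m ≃ Fin m) (c x : Fin m) : ℕ :=
  if prio.symm x < prio.symm c then 1 else 0

theorem tieBonus_self {m : ℕ} (prio : Fin m ≃ Fin m) (c : Fin m) : tieBonus prio c c = 0 := by
  simp [tieBonus]

/-- Scores are integers, so having to beat a candidate of higher priority strictly amounts to giving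
that candidate one extra point. -/
theorem isWinner_iff {ℓ m : ℕ} (a : Fin ℓ → ℕ) (prio : Fin m ≃ Fin m)
    (P : List (TopRanking ℓ m)) (c : Fin m) :
    IsWinner a prio P c ↔ ∀ x, score a P x + tieBonus prio c x ≤ score a P c := by
  constructor
  · rintro ⟨h₁, h₂⟩ x
    have := h₁ x
    unfold tieBonus
    split_ifs with h
    · rcases this.lt_or_eq with h' | h'
      · omega
      · exact absurd (h₂ x h') (not_le.2 h)
    · omega
  · intro h
    refine ⟨fun x => le_trans (Nat.le_add_right _ _) (h x), fun x hx => ?_⟩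
    by_contra hlt
    have := h x
    rw [tieBonus, if_pos (not_le.1 hlt)] at this
    omega

/-- If every candidate other than `c` is to be ranked a given number of times, at most `t` times
each and `t * k` times in total, then there are `t` votes doing so with `c` on top. -/
theorem exists_votes {k m b : ℕ} {a : Fin (k + 1) → ℕ} (hb : ∀ j : Fin k, a j.succ = b)
    (c : Fin m) (t : ℕ) (n : Fin m → ℕ) (hn : ∀ x, n x ≤ t) (hc : n c = 0)
    (hs : ∑ x, n x = t * k) :
    ∃ P : List (TopRanking (k + 1) m), P.length = t ∧ score a P c = t * a 0 ∧
      ∀ x, x ≠ c → score a P x = n x * b := by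
  induction t generalizing n with
  | zero =>
    refine ⟨[], rfl, by simp [score], fun x _ => ?_⟩
    have := hn x
    simp [score, Nat.le_zero.1 this]
  | succ t ih =>
    -- The candidates needed in all `t + 1` votes must be in the next one; the total `(t + 1) * k`
    -- leaves room for at most `k` of them.
    have h₁ : #{x | n x = t + 1} ≤ k := by
      have : #{x | n x = t + 1} * (t + 1) ≤ k * (t + 1) := by
        rw [mul_comm k, ← hs, ← smul_eq_mul, ← sum_const]
        calc ∑ x ∈ univ with n x = t + 1, (t + 1) = ∑ x ∈ univ with n x = t + 1, n x :=
              sum_congr rfl fun x hx => by simp at hx; exact hx.symm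
          _ ≤ ∑ x, n x := sum_le_sum_of_subset (filter_subset _ _)
      exact Nat.le_of_mul_le_mul_right this (Nat.succ_pos t)
    -- No candidate accounts for more than `t + 1` appearances, so at least `k` are still to be
    -- ranked.
    have h₂ : k ≤ #{x | 0 < n x} := by
      have : k * (t + 1) ≤ #{x | 0 < n x} * (t + 1) := by
        rw [mul_comm k, ← hs, ← smul_eq_mul, ← sum_const, sum_filter]
        refine sum_le_sum fun x _ => ?_
        split_ifs with h
        · exact hn x
        · omega
      exact Nat.le_of_mul_le_mul_right this (Nat.succ_pos t)
    -- `U` fills the lower positions of the next vote. As it contains all candidates with `n x = t +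
    -- 1`, the remaining counts are at most `t`.
    obtain ⟨U, hU₁, hU₂, hU⟩ := exists_subsuperset_card_eq (s := univ.filter fun x => n x = t + 1)
      (t := univ.filter fun x => 0 < n x) (monotone_filter_right _ fun x _ hx => by
        omega) h₁ h₂
    have hpos : ∀ x ∈ U, 0 < n x := fun x hx => by simpa using hU₂ hx
    have hcU : c ∉ U := fun h => by have := hpos c h; omega
    obtain ⟨P, hP, hPc, hPx⟩ := ih (fun x => n x - if x ∈ U then 1 else 0)
      (fun x => by
        have := hn x
        by_cases hx : x ∈ U
        · simp [hx]; omega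
        · have : n x ≠ t + 1 := fun h => hx (hU₁ (by simpa using h))
          simp [hx]; omega)
      (by simp [hc])
      (by
        have : ∑ x, (n x - if x ∈ U then 1 else 0) + ∑ x, (if x ∈ U then 1 else 0) = (t + 1) * k := by
          rw [← hs, ← sum_add_distrib]
          refine sum_congr rfl fun x _ => ?_
          by_cases hx : x ∈ U
          · have := hpos x hx
            simp [hx]; omega
          · simp [hx]
        simp [hU] at this
        linarith)
    let e : Fin k ≃ U := (U.equivFinOfCardEq hU).symm
    have he : ∀ j, (e j : Fin m) ∈ U := fun j => (e j).2
    let v : TopRanking (k + 1) m := ⟨Fin.cons c fun j => (e j : Fin m), by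
      rw [Fin.cons_injective_iff]
      refine ⟨?_, Subtype.val_injective.comp e.injective⟩
      rintro ⟨j, hj⟩
      exact hcU (hj ▸ he j)⟩
    have hv₀ : v 0 = c := rfl
    have hvs : ∀ j : Fin k, v j.succ = e j := fun j => rfl
    refine ⟨v :: P, by simp [hP], ?_, fun x hx => ?_⟩
    · rw [score_cons, hPc]
      have := voteScore_apply a v 0
      rw [hv₀] at this
      rw [this]
      ring
    · rw [score_cons, hPx x hx]
      by_cases hxU : x ∈ U
      · have hj : v (e.symm ⟨x, hxU⟩).succ = x := by simp [hvs]
        have := voteScore_apply a v (e.symm ⟨x, hxU⟩).succ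
        rw [hj, hb] at this
        rw [this]
        obtain ⟨i, hi⟩ := Nat.exists_eq_succ_of_ne_zero (hpos x hxU).ne'
        simp [hxU, hi]
        ring
      · rw [voteScore_eq_zero]
        · simp [hxU]
        · intro j
          refine Fin.cases ?_ (fun i => ?_) j
          · rw [hv₀]; exact hx.symm
          · rw [hvs]; exact fun h => hxU (h ▸ he i)

theorem exists_le_sum_eq {m : ℕ} {s : ℕ} (f : Fin m → ℕ) (h : s ≤ ∑ x, f x) :
    ∃ g : Fin m → ℕ, (∀ x, g x ≤ f x) ∧ ∑ x, g x = s := by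
  obtain ⟨d, hd⟩ := Nat.exists_eq_add_of_le h
  clear h
  induction d generalizing f with
  | zero => exact ⟨f, fun _ => le_rfl, hd⟩
  | succ d ih =>
    obtain ⟨x, -, hx⟩ : ∃ x ∈ univ, f x ≠ 0 := by
      by_contra! h
      have := sum_eq_zero h
      omega
    obtain ⟨g, hg, hs⟩ := ih (Function.update f x (f x - 1)) (by
      have h₁ := add_sum_erase univ f (mem_univ x)
      have h₂ := add_sum_erase univ (Function.update f x (f x - 1)) (mem_univ x)
      have h₃ : ∑ y ∈ univ.erase x, Function.update f x (f x - 1) y = ∑ y ∈ univ.erase x, f y :=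
        sum_congr rfl fun y hy => Function.update_of_ne (ne_of_mem_erase hy) _ _
      simp only [Function.update_self] at h₂
      omega)
    refine ⟨g, fun y => (hg y).trans ?_, hs⟩
    by_cases hy : y = x
    · subst hy; simp
    · simp [hy]

/-- How many of `t` votes can rank, with `b` points each, a candidate who exceeds the admissible
score by `e` points if ranked in all of them. -/
def capacity (b t e : ℕ) : ℕ := t - (e + b - 1) / b

theorem capacity_zero (b t : ℕ) : capacity b t 0 = t := by
  rcases Nat.eq_zero_or_pos b with rfl | h
  · simp [capacity]
  · simp [capacity, Nat.div_eq_of_lt (show b - 1 < b by omega)]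

/-- Both sides say `⌈e / b⌉ ≤ t - u`. The hypothesis `he` makes the truncated subtraction in
`capacity` exact, and it forces `e = 0` when `b = 0`, where division by zero gives capacity `t`. -/
theorem le_capacity_iff {b t e u : ℕ} (he : e ≤ b * t) (hu : u ≤ t) :
    u ≤ capacity b t e ↔ b * u + e ≤ b * t := by
  obtain ⟨d, rfl⟩ := Nat.exists_eq_add_of_le hu
  have h₁ : u ≤ capacity b (u + d) e ↔ (e + b - 1) / b ≤ d := by
    have : (e + b - 1) / b ≤ u + d := by
      rcases Nat.eq_zero_or_pos b with rfl | h
      · simp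
      · rw [← Nat.lt_succ_iff, Nat.div_lt_iff_lt_mul h, Nat.succ_eq_add_one, mul_comm]
        rw [mul_add, mul_add] at *
        omega
    unfold capacity
    omega
  rw [h₁, mul_add]
  rcases Nat.eq_zero_or_pos b with rfl | h
  · simpa using he
  · rw [← Nat.lt_succ_iff, Nat.div_lt_iff_lt_mul h, Nat.succ_eq_add_one, mul_comm, mul_add]
    omega

/-- The number of points by which `x`, with score `s`, would beat the target candidate, with score
`r`, if the target is ranked first and `x` is ranked lower in all of `t` further votes. -/
def excess {m : ℕ} (prio : Fin m ≃ Fin m) (c : Fin m) (s : Fin m → ℕ) (d t : ℕ) (x : Fin m) : ℕ :=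
  s x + tieBonus prio c x - (s c + t * d)

/-- The numerical criterion for winning with `t` absent votes. -/
def Feasible {m : ℕ} (prio : Fin m ≃ Fin m) (c : Fin m) (s : Fin m → ℕ) (ℓ b d t : ℕ) : Prop :=
  (∀ x, excess prio c s d t x ≤ b * t) ∧
    t * ℓ ≤ ∑ x, capacity b t (excess prio c s d t x)

theorem excess_self {m : ℕ} (prio : Fin m ≃ Fin m) (c : Fin m) (s : Fin m → ℕ) (d t : ℕ) :
    excess prio c s d t c = 0 := by
  simp [excess, tieBonus_self]

/-- Necessity needs no exchange argument that puts `c` on top: the upper bound on the score of `c`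
and the lower bounds on the other scores hold for all votes. Counting `c` with capacity `t` makes
the demand `t * ℓ` instead of `t * (ℓ - 1)`. -/
theorem isYes_iff {k b d : ℕ} {a : Fin (k + 1) → ℕ} (hb : ∀ j : Fin k, a j.succ = b)
    (hd : a 0 = b + d) (I : Instance (k + 1)) :
    IsYes a I ↔ Feasible I.prio I.target (score a I.known) (k + 1) b d I.t := by
  obtain ⟨m, prio, P, t, c⟩ := I
  have hba : ∀ j, b ≤ a j := fun j => by
    refine Fin.cases ?_ (fun i => ?_) j
    · omega
    · exact (hb i).ge
  have hab : ∀ j, a j ≤ b + d := fun j => by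
    refine Fin.cases ?_ (fun i => ?_) j
    · omega
    · rw [hb]; omega
  simp only [IsYes, isWinner_iff, score_append]
  constructor
  · rintro ⟨Q, hQ, hw⟩
    -- The number of appearances of `x` in `Q` respects the capacity; summing over `x` gives the
    -- number of positions.
    have key : ∀ x, score (fun _ => 1) Q x ≤ t ∧ excess prio c (score a P) d t x ≤ b * t ∧
        score (fun _ => 1) Q x ≤ capacity b t (excess prio c (score a P) d t x) := by
      intro x
      have h₁ : score (fun _ => 1) Q x ≤ t := by
        simpa [hQ] using score_le (a := fun _ => 1) (A := 1) (fun _ => le_rfl) Q x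
      by_cases hx : x = c
      · subst hx
        simpa [excess_self, capacity_zero] using h₁
      · have h₂ := mul_score_one_le hba Q x
        have h₃ := score_le hab Q c
        have h₄ := hw x
        rw [hQ, mul_add, mul_comm t b] at h₃
        have h₅ : b * score (fun _ => 1) Q x ≤ b * t := Nat.mul_le_mul_left _ h₁
        have h₆ : b * score (fun _ => 1) Q x + excess prio c (score a P) d t x ≤ b * t := by
          unfold excess
          omega
        have h₇ : excess prio c (score a P) d t x ≤ b * t := by omega
        exact ⟨h₁, h₇, (le_capacity_iff h₇ h₁).2 h₆⟩
    refine ⟨fun x => (key x).2.1, ?_⟩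
    have := sum_score (fun _ => 1) Q
    simp only [sum_const, card_univ, Fintype.card_fin, smul_eq_mul, mul_one, hQ] at this
    rw [← this]
    exact sum_le_sum fun x _ => (key x).2.2
  · rintro ⟨h₁, h₂⟩
    set f : Fin m → ℕ := fun x =>
      if x = c then 0 else capacity b t (excess prio c (score a P) d t x) with hf
    have hsum : t * k ≤ ∑ x, f x := by
      have e₁ := add_sum_erase univ (fun x => capacity b t (excess prio c (score a P) d t x))
        (mem_univ c)
      have e₂ := add_sum_erase univ f (mem_univ c)
      have e₃ : ∑ x ∈ univ.erase c, f x =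
          ∑ x ∈ univ.erase c, capacity b t (excess prio c (score a P) d t x) :=
        sum_congr rfl fun x hx => by simp [hf, ne_of_mem_erase hx]
      have e₄ : f c = 0 := by simp [hf]
      simp only [excess_self, capacity_zero] at e₁
      rw [mul_add] at h₂
      omega
    -- Without `c` the capacities still add up to at least `t * k`; they are lowered to that exact
    -- total.
    obtain ⟨n, hn, hns⟩ := exists_le_sum_eq f hsum
    have hnt : ∀ x, n x ≤ t := fun x => (hn x).trans (by
      simp only [hf]
      split_ifs
      · omega
      · exact Nat.sub_le _ _)
    obtain ⟨Q, hQ, hQc, hQx⟩ := exists_votes hb c t n hnt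
      (Nat.le_zero.1 ((hn c).trans (by simp [hf]))) hns
    refine ⟨Q, hQ, fun x => ?_⟩
    by_cases hx : x = c
    · subst hx
      simp [tieBonus_self]
    · rw [hQx x hx, hQc, hd]
      have h₃ := hn x
      simp only [hf, hx, if_false] at h₃
      have h₄ := (le_capacity_iff (h₁ x) (hnt x)).1 h₃
      have h₅ : n x * b = b * n x := mul_comm _ _
      have h₆ : t * (b + d) = b * t + t * d := by ring
      unfold excess at h₄
      omega

/-! ### Cutting off the number of absent votes -/

/-- If `d > 0`, then `N` votes wipe out every excess and only `ℓ ≤ m` remains. If `d = 0`, the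
excesses do not depend on `t`, and for `b > 0` the criterion is a linear inequality in `t` whose
truth value is constant from `N` on. -/
theorem feasible_min_iff {m : ℕ} (prio : Fin m ≃ Fin m) (c : Fin m) (s : Fin m → ℕ) {ℓ b d t N : ℕ}
    (hs : b = 0 → d = 0 → ∀ x, s x = 0) (hN : ∑ x, (s x + 1) ≤ N) :
    Feasible prio c s ℓ b d (min t N) ↔ Feasible prio c s ℓ b d t := by
  rcases le_total t N with h | h
  · rw [min_eq_left h]
  rw [min_eq_right h]
  have hbonus : ∀ x, tieBonus prio c x ≤ 1 := fun x => by unfold tieBonus; split_ifs <;> simp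
  have hsN : ∀ x, s x + 1 ≤ N := fun x =>
    (single_le_sum (f := fun x => s x + 1) (fun _ _ => Nat.zero_le _) (mem_univ x)).trans hN
  have hN₀ : 1 ≤ N := le_trans (Nat.le_add_left _ _) (hsN c)
  rcases Nat.eq_zero_or_pos d with rfl | hd
  · have hE : ∀ t x, excess prio c s 0 t x = s x + tieBonus prio c x - s c := fun t x => by
      simp [excess]
    simp only [Feasible, hE]
    rcases Nat.eq_zero_or_pos b with rfl | hb
    · simp only [zero_mul, capacity, Nat.div_zero, sum_const, card_univ, Fintype.card_fin,
        smul_eq_mul, Nat.sub_zero]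
      refine and_congr_right fun _ => ?_
      rw [mul_comm m, mul_comm m, Nat.mul_le_mul_left_iff (by omega),
        Nat.mul_le_mul_left_iff (by omega)]
    · set e : Fin m → ℕ := fun x => s x + tieBonus prio c x - s c
      have he : ∀ x, e x ≤ s x + 1 := fun x => by have := hbonus x; simp only [e]; omega
      have hdiv : ∀ x, (e x + b - 1) / b ≤ e x := fun x => by
        rw [← Nat.lt_succ_iff, Nat.div_lt_iff_lt_mul hb, Nat.succ_eq_add_one, add_mul, one_mul]
        have := Nat.le_mul_of_pos_right (e x) hb
        omega
      -- From `N` on, no subtraction in a capacity is truncated, so the capacities add up to `t * m`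
      -- minus a constant `D ≤ N`.
      have key : ∀ t, N ≤ t → ((∀ x, e x ≤ b * t) ∧ t * ℓ ≤ ∑ x, capacity b t (e x) ↔
          ∑ x, (e x + b - 1) / b + t * ℓ ≤ t * m) := by
        intro t ht
        have h₁ : ∀ x, e x ≤ b * t := fun x =>
          (he x).trans ((hsN x).trans (ht.trans (Nat.le_mul_of_pos_left t hb)))
        have h₂ : ∑ x, capacity b t (e x) + ∑ x, (e x + b - 1) / b = t * m := by
          rw [← sum_add_distrib]
          have : ∀ x ∈ (univ : Finset (Fin m)), capacity b t (e x) + (e x + b - 1) / b = t :=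
            fun x _ => by
              have h₁ := hdiv x
              have h₂ := he x
              have h₃ := hsN x
              unfold capacity
              omega
          rw [sum_congr rfl this]
          simp [mul_comm]
        constructor
        · rintro ⟨-, h⟩; omega
        · intro h; exact ⟨h₁, by omega⟩
      rw [key N le_rfl, key t h]
      have hD : ∑ x, (e x + b - 1) / b ≤ N :=
        (sum_le_sum fun x _ => (hdiv x).trans (he x)).trans hN
      generalize ∑ x, (e x + b - 1) / b = D at hD
      -- The inequality `D + t * ℓ ≤ t * m` fails for `m < ℓ`, means `D = 0` for `m = ℓ`, and holds
      -- for `m > ℓ` since `D ≤ N ≤ t`.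
      rcases lt_trichotomy m ℓ with hm | rfl | hm
      · have h₁ := Nat.mul_lt_mul_of_pos_left hm (show 0 < N by omega)
        have h₂ := Nat.mul_lt_mul_of_pos_left hm (show 0 < t by omega)
        omega
      · omega
      · have h₁ := Nat.mul_le_mul_left N (show ℓ + 1 ≤ m from hm)
        have h₂ := Nat.mul_le_mul_left t (show ℓ + 1 ≤ m from hm)
        rw [mul_add] at h₁ h₂
        omega
  · have key : ∀ t, N ≤ t → (Feasible prio c s ℓ b d t ↔ ℓ ≤ m) := by
      intro t ht
      have hE : ∀ x, excess prio c s d t x = 0 := fun x => by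
        have h₁ := hbonus x
        have h₂ := hsN x
        have h₃ := Nat.le_mul_of_pos_right t hd
        unfold excess
        omega
      simp only [Feasible, hE, capacity_zero, sum_const, card_univ, Fintype.card_fin, smul_eq_mul,
        Nat.zero_le, implies_true, true_and]
      rw [mul_comm m, Nat.mul_le_mul_left_iff (by omega)]
    rw [key N le_rfl, key t h]

end WAV

namespace WAV

/-! ### Stores and execution rules for the decision program -/

open StackProgram StackProgram.Prog

/-- The stacks used by the decision program. -/
inductive Stack : Type
  | inp | tmp | bound | tgt | cnt | aux | cand | name | seen | miss | low | pts | base | slots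
  | past | fail | out
  deriving DecidableEq

instance : Fintype Stack where
  elems := {.inp, .tmp, .bound, .tgt, .cnt, .aux, .cand, .name, .seen, .miss, .low, .pts, .base,
    .slots, .past, .fail, .out}
  complete k := by cases k <;> decide

/-- The contents of all stacks. -/
structure Store where
  /-- the unread input; later the known votes -/
  inp : List Sym := []
  /-- symbols in transit -/
  tmp : List Sym := []
  /-- the bound at which the number of absent votes is cut off, in unary -/
  bound : List Sym := []
  /-- the name of the target candidate -/
  tgt : List Sym := []
  /-- the number of absent votes, in unary -/
  cnt : List Sym := []
  /-- unary scratch space -/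
  aux : List Sym := []
  /-- the names of the candidates -/
  cand : List Sym := []
  /-- the part of a candidate's name which has not been compared yet -/
  name : List Sym := []
  /-- the part of a candidate's name which has been compared -/
  seen : List Sym := []
  /-- nonempty after a mismatch -/
  miss : List Sym := []
  /-- nonempty below the top position of a vote -/
  low : List Sym := []
  /-- the points of a candidate, in unary -/
  pts : List Sym := []
  /-- the points that a candidate may have without exceeding the target, in unary -/
  base : List Sym := []
  /-- the number of positions that can be filled, in unary -/
  slots : List Sym := []
  /-- nonempty once the target has been met in the priority list -/
  past : List Sym := []
  /-- nonempty if the target cannot win -/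
  fail : List Sym := []
  /-- the answer -/
  out : List Sym := []

namespace Store

/-- The contents of a stack. -/
def get (s : Store) : Stack → List Sym
  | .inp => s.inp | .tmp => s.tmp | .bound => s.bound | .tgt => s.tgt | .cnt => s.cnt
  | .aux => s.aux | .cand => s.cand | .name => s.name | .seen => s.seen | .miss => s.miss
  | .low => s.low | .pts => s.pts | .base => s.base | .slots => s.slots | .past => s.past
  | .fail => s.fail | .out => s.out

/-- Replace the contents of a stack. -/
def set (s : Store) (k : Stack) (l : List Sym) : Store :=
  match k with
  | .inp => { s with inp := l } | .tmp => { s with tmp := l } | .bound => { s with bound := l }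
  | .tgt => { s with tgt := l } | .cnt => { s with cnt := l } | .aux => { s with aux := l }
  | .cand => { s with cand := l } | .name => { s with name := l } | .seen => { s with seen := l }
  | .miss => { s with miss := l } | .low => { s with low := l } | .pts => { s with pts := l }
  | .base => { s with base := l } | .slots => { s with slots := l } | .past => { s with past := l }
  | .fail => { s with fail := l } | .out => { s with out := l }

/-- Runs are about functions on stacks. Passing to records lets concrete updates be computed
definitionally, so that consecutive executions fit together without rewriting. -/
theorem update_get (s : Store) (k : Stack) (l : List Sym) :
    Function.update s.get k l = (s.set k l).get := by
  funext k'
  by_cases h : k' = k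
  · subst h
    rw [Function.update_self]
    cases k' <;> rfl
  · rw [Function.update_of_ne h]
    cases k <;> cases k' <;> first | rfl | exact absurd rfl h

@[simp] theorem get_set (s : Store) (k : Stack) (l : List Sym) : (s.set k l).get k = l := by
  cases k <;> rfl

@[simp] theorem set_set (s : Store) (k : Stack) (l l' : List Sym) :
    (s.set k l).set k l' = s.set k l' := by
  cases k <;> rfl

@[simp] theorem set_get (s : Store) (k : Stack) : s.set k (s.get k) = s := by
  cases k <;> rfl

theorem get_set_of_ne (s : Store) {k k' : Stack} (h : k' ≠ k) (l : List Sym) :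
    (s.set k l).get k' = s.get k' := by
  rw [← update_get, Function.update_of_ne h]

theorem set_comm (s : Store) {k k' : Stack} (h : k' ≠ k) (l l' : List Sym) :
    (s.set k l).set k' l' = (s.set k' l').set k l := by
  cases k <;> cases k' <;> first | rfl | exact absurd rfl h

end Store

/-- `Exec p s s' n`: the program `p` takes the store `s` to `s'` within `n` steps. -/
def Exec (p : Prog Stack Sym) (s s' : Store) (n : ℕ) : Prop := Runs p s.get s'.get n

namespace Exec

variable {p q : Prog Stack Sym} {s s' s'' : Store} {n m : ℕ} {k k' : Stack} {a : Sym}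
  {l : List Sym} {isEnd : Sym → Bool}

theorem mono (h : Exec p s s' n) (hnm : n ≤ m) : Exec p s s' m := Runs.mono h hnm

theorem skip (s : Store) : Exec skip s s 1 := Runs.skip _

theorem push (s : Store) (k : Stack) (a : Sym) : Exec (push k a) s (s.set k (a :: s.get k)) 1 := by
  rw [Exec, ← Store.update_get]
  exact Runs.push k a _

theorem seq (h : Exec p s s' n) (h' : Exec q s' s'' m) : Exec (p ;; q) s s'' (n + m) :=
  Runs.seq h h'

theorem loop_nil {body : Sym → Prog Stack Sym} (h : s.get k = []) :
    Exec (loop k isEnd body) s s 1 := Runs.loop_nil h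

theorem loop_end {body : Sym → Prog Stack Sym} (h : s.get k = a :: l) (ha : isEnd a = true) :
    Exec (loop k isEnd body) s (s.set k l) 1 := by
  rw [Exec, ← Store.update_get]
  exact Runs.loop_end h ha

theorem loop_cons {body : Sym → Prog Stack Sym} (h : s.get k = a :: l) (ha : isEnd a = false)
    (h₁ : Exec (body a) (s.set k l) s' n) (h₂ : Exec (loop k isEnd body) s' s'' m) :
    Exec (loop k isEnd body) s s'' (n + m + 1) := by
  rw [Exec, ← Store.update_get] at h₁
  exact Runs.loop_cons h ha h₁ h₂

theorem popCase_nil {body : Option Sym → Prog Stack Sym} (h : s.get k = [])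
    (h₁ : Exec (body none) s s' n) : Exec (popCase k body) s s' (n + 1) := by
  refine Runs.popCase ?_
  have : s.set k [] = s := by rw [← h, Store.set_get]
  rw [h, Store.update_get, List.tail_nil, this]
  exact h₁

theorem popCase_cons {body : Option Sym → Prog Stack Sym} (h : s.get k = a :: l)
    (h₁ : Exec (body (some a)) (s.set k l) s' n) : Exec (popCase k body) s s' (n + 1) := by
  refine Runs.popCase ?_
  rw [h, Store.update_get]
  exact h₁

/-- Running the body of a loop on the first symbols of a stack. -/
theorem loop_prefix {β : Type} {body : Sym → Prog Stack Sym} (φ : β → Store)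
    (step : β → Sym → β) (Inv : List Sym → β → Prop) (c : ℕ) (r : List Sym)
    (hbody : ∀ a l x, Inv (a :: l) x → isEnd a = false ∧
      Exec (body a) ((φ x).set k (l ++ r)) ((φ (step x a)).set k (l ++ r)) c ∧ Inv l (step x a)) :
    ∀ (l : List Sym) (x : β), Inv l x → ∀ {s : Store} {m : ℕ},
      Exec (loop k isEnd body) ((φ (l.foldl step x)).set k r) s m →
      Exec (loop k isEnd body) ((φ x).set k (l ++ r)) s ((c + 1) * l.length + m)
  | [], x, _, s, m, h => by simpa using h
  | a :: l, x, hx, s, m, h => by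
    obtain ⟨h₁, h₂, h₃⟩ := hbody a l x hx
    refine (loop_cons (a := a) (l := l ++ r) (s' := (φ (step x a)).set k (l ++ r)) (by simp) h₁
      (by simpa using h₂) (loop_prefix φ step Inv c r hbody l _ h₃ h)).mono ?_
    rw [List.length_cons, mul_add]
    omega

/-- Running a loop until the stack is empty. -/
theorem loop_all {β : Type} {body : Sym → Prog Stack Sym} (φ : β → Store)
    (step : β → Sym → β) (Inv : List Sym → β → Prop) (c : ℕ)
    (hbody : ∀ a l x, Inv (a :: l) x → isEnd a = false ∧
      Exec (body a) ((φ x).set k l) ((φ (step x a)).set k l) c ∧ Inv l (step x a))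
    (l : List Sym) (x : β) (hx : Inv l x) :
    Exec (loop k isEnd body) ((φ x).set k l) ((φ (l.foldl step x)).set k [])
      ((c + 1) * l.length + 1) := by
  have := loop_prefix (k := k) (isEnd := isEnd) (body := body) φ step Inv c []
    (by simpa using hbody) l x hx (loop_nil (by simp))
  simpa using this

end Exec

/-- Pop a symbol, run `p` if there is none and `q a` if it is `a`. -/
def ifPop (k : Stack) (p : Prog Stack Sym) (q : Sym → Prog Stack Sym) : Prog Stack Sym :=
  popCase k fun o => o.elim p q

namespace Exec

variable {p : Prog Stack Sym} {q : Sym → Prog Stack Sym} {s s' : Store} {n : ℕ} {k : Stack}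
  {a : Sym} {l : List Sym}

theorem ifPop_nil (h : s.get k = []) (h₁ : Exec p s s' n) : Exec (ifPop k p q) s s' (n + 1) :=
  popCase_nil h h₁

theorem ifPop_cons (h : s.get k = a :: l) (h₁ : Exec (q a) (s.set k l) s' n) :
    Exec (ifPop k p q) s s' (n + 1) :=
  popCase_cons h h₁

end Exec

/-- A number in unary. -/
abbrev unary (n : ℕ) : List Sym := List.replicate n Sym.comma

/-- The end condition that never holds. -/
abbrev never : Sym → Bool := fun _ => false

/-- Push a unary number. -/
def pushes (k : Stack) : ℕ → Prog Stack Sym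
  | 0 => skip
  | n + 1 => push k Sym.comma ;; pushes k n

/-- Pop a number of symbols. -/
def pops (k : Stack) : ℕ → Prog Stack Sym
  | 0 => skip
  | n + 1 => popCase k fun _ => pops k n

/-- Move the symbols of a stack to another one, reversing their order. -/
def move (k k' : Stack) : Prog Stack Sym := loop k never fun y => push k' y

/-- Empty a stack. -/
def clear (k : Stack) : Prog Stack Sym := loop k never fun _ => skip

theorem unary_append (n m : ℕ) : unary n ++ unary m = unary (n + m) := by
  simp [unary]

theorem foldl_const {β : Type} (f : β → β) (l : List Sym) (x : β) :
    l.foldl (fun x _ => f x) x = f^[l.length] x := by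
  induction l generalizing x with
  | nil => rfl
  | cons a l ih => rw [List.foldl_cons, ih, List.length_cons, Function.iterate_succ_apply]

namespace Exec

theorem pushes (s : Store) (k : Stack) (n : ℕ) :
    Exec (pushes k n) s (s.set k (unary n ++ s.get k)) (n + 1) := by
  induction n generalizing s with
  | zero =>
    rw [show unary 0 ++ s.get k = s.get k from rfl, Store.set_get]
    exact Exec.skip s
  | succ n ih =>
    have := (Exec.push s k Sym.comma).seq (ih _)
    simp only [Store.set_set, Store.get_set] at this
    rw [show unary (n + 1) ++ s.get k = unary n ++ Sym.comma :: s.get k by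
      simp [unary, List.replicate_succ']]
    exact this.mono (by omega)

theorem pops (s : Store) (k : Stack) (n : ℕ) :
    Exec (pops k n) s (s.set k ((s.get k).drop n)) (n + 1) := by
  induction n generalizing s with
  | zero =>
    rw [List.drop_zero, Store.set_get]
    exact Exec.skip s
  | succ n ih =>
    rcases h : s.get k with _ | ⟨a, l⟩
    · refine popCase_nil h ?_
      simpa [h] using ih s
    · refine popCase_cons h ?_
      simpa using ih (s.set k l)

theorem move (s : Store) {k k' : Stack} (h : k' ≠ k) :
    Exec (move k k') s ((s.set k []).set k' ((s.get k).reverse ++ s.get k'))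
      (2 * (s.get k).length + 1) := by
  have := loop_all (k := k) (isEnd := never) (body := fun y => .push k' y)
    (fun r => s.set k' r) (fun r a => a :: r) (fun _ _ => True) 1
    (fun a l x _ => ⟨rfl, by
      have := push ((s.set k' x).set k l) k' a
      rwa [Store.get_set_of_ne _ h, Store.get_set, Store.set_comm _ h, Store.set_set] at this,
      trivial⟩)
    (s.get k) (s.get k') trivial
  rw [Store.set_get, Store.set_get] at this
  rw [Store.set_comm _ h]
  exact (by simpa using this : Exec (loop k never fun y => .push k' y) _ _ _)

theorem clear (s : Store) (k : Stack) :
    Exec (clear k) s (s.set k []) (2 * (s.get k).length + 1) := by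
  have := loop_all (k := k) (isEnd := never) (body := fun _ => .skip)
    (fun _ : Unit => s) (fun r _ => r) (fun _ _ => True) 1
    (fun a l x _ => ⟨rfl, skip _, trivial⟩) (s.get k) () trivial
  exact (by simpa using this : Exec (loop k never fun _ => .skip) _ _ _)

end Exec

/-! ### Comparing names of candidates -/

/-- One step of the comparison of a name with a string of symbols: the part of the name that is to
be compared, the part that has been compared, and the record of mismatches. -/
def compareStep : List Sym × List Sym × List Sym → Sym → List Sym × List Sym × List Sym
  | ([], y, f), _ => ([], y, Sym.comma :: f)
  | (z :: x, y, f), b => (x, z :: y, if z = b then f else Sym.comma :: f)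

/-- The three facts serve to restore the name, to bound the cost of clearing the mismatches, and to
read off the verdict: equality holds exactly when the name is used up without mismatch. A name that
is too short leaves a mismatch, one that is too long a remainder. -/
theorem foldl_compareStep (u x y f : List Sym) :
    (u.foldl compareStep (x, y, f)).2.1.reverse ++ (u.foldl compareStep (x, y, f)).1 =
        y.reverse ++ x ∧
      (u.foldl compareStep (x, y, f)).2.2.length ≤ f.length + u.length ∧
      ((u.foldl compareStep (x, y, f)).1 = [] ∧ (u.foldl compareStep (x, y, f)).2.2 = [] ↔
        f = [] ∧ x = u) := by
  induction u generalizing x y f with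
  | nil => exact ⟨rfl, le_rfl, and_comm⟩
  | cons b u ih =>
    rw [List.foldl_cons]
    rcases x with _ | ⟨z, x⟩
    · obtain ⟨h₁, h₂, h₃⟩ := ih [] y (Sym.comma :: f)
      refine ⟨by simpa [compareStep] using h₁, ?_, ?_⟩
      · simp only [compareStep, List.length_cons] at *
        omega
      · simpa [compareStep] using h₃
    · obtain ⟨h₁, h₂, h₃⟩ := ih x (z :: y) (if z = b then f else Sym.comma :: f)
      refine ⟨by simpa [compareStep] using h₁, ?_, ?_⟩
      · simp only [compareStep, List.length_cons] at *
        have : (if z = b then f else Sym.comma :: f).length ≤ f.length + 1 := by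
          split_ifs <;> simp
        omega
      · simp only [compareStep]
        rw [h₃]
        split_ifs with h <;> simp [h]

theorem foldl_prod_compareStep (u v : List Sym) (r : List Sym × List Sym × List Sym) :
    u.foldl (fun p a => (a :: p.1, compareStep p.2 a)) (v, r) =
      (u.reverse ++ v, u.foldl compareStep r) := by
  induction u generalizing v r with
  | nil => rfl
  | cons a u ih => simp [ih]

/-- Compare the next symbol of the name with `y`. -/
def matchSym (y : Sym) : Prog Stack Sym :=
  ifPop .name (push .miss Sym.comma) fun z =>
    push .seen z ;; if z = y then skip else push .miss Sym.comma

/-- Run `p` if the comparison has been successful and `q` otherwise, and restore the name. -/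
def endName (p q : Prog Stack Sym) : Prog Stack Sym :=
  ifPop .name (ifPop .miss p fun _ => clear .miss ;; q)
    (fun z => push .name z ;; clear .miss ;; q) ;;
  move .seen .name

theorem exec_matchSym (s : Store) (b : Sym) :
    Exec (matchSym b) s
      { s with
        name := (compareStep (s.name, s.seen, s.miss) b).1
        seen := (compareStep (s.name, s.seen, s.miss) b).2.1
        miss := (compareStep (s.name, s.seen, s.miss) b).2.2 } 3 := by
  obtain ⟨_, _, _, _, _, _, _, x, y, f, _, _, _, _, _, _, _⟩ := s
  rcases x with _ | ⟨z, x⟩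
  · exact (Exec.ifPop_nil rfl (Exec.push _ _ _)).mono (by omega)
  · refine (Exec.ifPop_cons (a := z) (l := x) rfl
      ((Exec.push _ _ _).seq (m := 1) ?_)).mono le_rfl
    by_cases h : z = b
    · simp only [h, if_true, compareStep]
      exact Exec.skip _
    · simp only [h, if_false, compareStep]
      exact Exec.push _ _ _

/-- The branches run while the name is still split between `name` and `seen`; only afterwards is the
compared part put back. The test for a remainder pops a symbol, which is returned. -/
theorem exec_endName {p q : Prog Stack Sym} {s s' : Store} {n : ℕ}
    (h : Exec (if s.name = [] ∧ s.miss = [] then p else q) { s with miss := [] } s' n) :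
    Exec (endName p q) s { s' with seen := [], name := s'.seen.reverse ++ s'.name }
      (n + 2 * s.miss.length + 2 * s'.seen.length + 5) := by
  have key : ∀ {r}, Exec r s s' (n + 2 * s.miss.length + 4) → Exec (r ;; move .seen .name) s
      { s' with seen := [], name := s'.seen.reverse ++ s'.name }
      (n + 2 * s.miss.length + 2 * s'.seen.length + 5) := fun hr =>
    (hr.seq (Exec.move s' (k := .seen) (k' := .name) (by decide))).mono (by
      simp only [Store.get]; omega)
  refine key ?_
  obtain ⟨_, _, _, _, _, _, _, x, y, f, _, _, _, _, _, _, _⟩ := s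
  rcases x with _ | ⟨z, x⟩
  · rcases f with _ | ⟨e, f⟩
    · simp only [and_self, if_true] at h
      exact (Exec.ifPop_nil rfl (Exec.ifPop_nil rfl h)).mono (by omega)
    · simp only [List.cons_ne_nil, and_false, if_false] at h
      refine (Exec.ifPop_nil rfl (Exec.ifPop_cons (a := e) (l := f) rfl
        ((Exec.clear _ _).seq h))).mono ?_
      simp only [Store.get, Store.set, List.length_cons]
      omega
  · simp only [List.cons_ne_nil, false_and, if_false] at h
    refine (Exec.ifPop_cons (a := z) (l := x) rfl ((Exec.push _ _ _).seq
      ((Exec.clear _ _).seq h))).mono ?_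
    simp only [Store.get, Store.set]
    omega

/-- The name of a candidate as a string. -/
def nameBits (n : ℕ) : List Sym := (Computability.encodeNat n).map Sym.bit

theorem nameBits_inj {n k : ℕ} : nameBits n = nameBits k ↔ n = k :=
  ⟨fun h => (encodeNum_append_inj (u := []) (v := []) (by
    simpa [encodeNum, nameBits] using h)).1, fun h => h ▸ rfl⟩

theorem encodeNum_eq (n : ℕ) : encodeNum n = nameBits n ++ [Sym.comma] := rfl

/-- Mark the target as met if its name is the given one. -/
def cmpTarget : Prog Stack Sym :=
  loop .tgt never (fun y => push .tmp y ;; matchSym y) ;;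
  endName (push .past Sym.comma) skip ;; move .tmp .tgt

/-- Each symbol of the target costs at most 5 steps to compare, 2 to clear a mismatch and 2 to move
back. -/
theorem exec_cmpTarget (s : Store) :
    Exec cmpTarget { s with tmp := [], seen := [], miss := [] }
      { s with
        tmp := []
        seen := []
        miss := []
        past := if s.name = s.tgt then Sym.comma :: s.past else s.past }
      (9 * s.tgt.length + 2 * s.name.length + 10) := by
  have hl := Exec.loop_all (k := .tgt) (isEnd := never)
    (body := fun y => push .tmp y ;; matchSym y)
    (fun r : List Sym × List Sym × List Sym × List Sym =>
      { s with tmp := r.1, name := r.2.1, seen := r.2.2.1, miss := r.2.2.2 })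
    (fun p a => (a :: p.1, compareStep p.2 a)) (fun _ _ => True) 4
    (fun a l p _ => ⟨rfl, ((Exec.push _ _ _).seq (exec_matchSym _ _)), trivial⟩)
    s.tgt ([], s.name, [], []) trivial
  rw [foldl_prod_compareStep] at hl
  obtain ⟨e₁, e₂, e₃⟩ := foldl_compareStep s.tgt s.name [] []
  revert hl e₁ e₂ e₃
  generalize s.tgt.foldl compareStep (s.name, [], []) = r
  obtain ⟨x, y, f⟩ := r
  intro hl e₁ e₂ e₃
  dsimp only at *
  simp only [List.reverse_nil, List.nil_append, true_and, List.length_nil, zero_add] at e₁ e₂ e₃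
  have hy : y.length ≤ s.name.length := by rw [← e₁]; simp
  have he := exec_endName (p := push .past Sym.comma) (q := skip)
    (s := { s with tmp := s.tgt.reverse ++ [], tgt := [], name := x, seen := y, miss := f })
    (s' := { s with
      tmp := s.tgt.reverse ++ [], tgt := [], name := x, seen := y, miss := []
      past := if s.name = s.tgt then Sym.comma :: s.past else s.past }) (n := 1) (by
    simp only [e₃]
    split_ifs
    · exact Exec.push _ _ _
    · exact Exec.skip _)
  have hm := Exec.move { s with
    tmp := s.tgt.reverse ++ [], tgt := [], name := y.reverse ++ x, seen := [], miss := []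
    past := if s.name = s.tgt then Sym.comma :: s.past else s.past }
    (k := .tmp) (k' := .tgt) (by decide)
  have := hl.seq (he.seq hm)
  simp only [Store.set, Store.get, e₁, List.append_nil, List.reverse_reverse, List.length_reverse]
    at this
  exact this.mono (by omega)

/-! ### Computing scores from the known votes -/

/-- Give `a` points at the top position of a vote and `b` points below. -/
def addPts (a b : ℕ) : Prog Stack Sym :=
  ifPop .low (push .low Sym.comma ;; pushes .pts a) fun _ => push .low Sym.comma ;; pushes .pts b

/-- Leave the top position of a vote. -/
def leaveTop : Prog Stack Sym := ifPop .low (push .low Sym.comma) fun _ => push .low Sym.comma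

theorem exec_addPts (a b : ℕ) (s : Store) (hlow : s.low = [] ∨ s.low = [Sym.comma]) :
    Exec (addPts a b) s
      { s with low := [Sym.comma], pts := unary (if s.low = [] then a else b) ++ s.pts }
      (a + b + 3) := by
  rcases hlow with hl | hl
  · have := (Exec.push s .low Sym.comma).seq (Exec.pushes _ .pts a)
    simp only [Store.get, Store.set, hl] at this
    simp only [hl, if_true]
    exact (Exec.ifPop_nil (s := s) (k := .low) hl this).mono (by omega)
  · simp only [hl, List.cons_ne_nil, if_false]
    exact (Exec.ifPop_cons (s := s) (k := .low) hl ((Exec.push _ _ _).seq (Exec.pushes _ _ _))).mono (by omega)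

theorem exec_leaveTop (s : Store) (hlow : s.low = [] ∨ s.low = [Sym.comma]) :
    Exec leaveTop s { s with low := [Sym.comma] } 2 := by
  rcases hlow with hl | hl
  · have := Exec.push s .low Sym.comma
    simp only [Store.get, Store.set, hl] at this
    exact Exec.ifPop_nil (s := s) (k := .low) hl this
  · exact Exec.ifPop_cons (s := s) (k := .low) hl (Exec.push _ _ _)

/-- Process a symbol of the known votes: `a` points are given to the top position and `b` points to
the other ones. -/
def scanSym (a b : ℕ) : Sym → Prog Stack Sym
  | .bit β => matchSym (.bit β)
  | .comma => endName (addPts a b) leaveTop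
  | .semi => ifPop .low skip fun _ => skip

/-- The loop over the known votes. -/
def scanLoop (a b : ℕ) : Prog Stack Sym :=
  loop .inp never fun y => push .tmp y ;; scanSym a b y

/-- The points of candidate `x` in a vote given as a list of names, if the first of them gets `w`
points and the other ones get `b` points. -/
def namePts (w b x : ℕ) : List ℕ → ℕ
  | [] => 0
  | y :: l => (if x = y then w else 0) + namePts b b x l

/-- One loop passes over all votes, so the end of a name is not the end of a program; the rest of
the loop enters as the hypothesis `h`. A cost proportional to the length of the code adds up under
concatenation. -/
theorem exec_scanName (a b : ℕ) (s : Store) (hlow : s.low = [] ∨ s.low = [Sym.comma]) (y : ℕ)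
    (rest : List Sym) {s'' : Store} {m : ℕ}
    (h : Exec (scanLoop a b) { s with
      inp := rest
      tmp := (encodeNum y).reverse ++ s.tmp
      seen := []
      miss := []
      low := [Sym.comma]
      pts := unary (if s.name = nameBits y then if s.low = [] then a else b else 0) ++ s.pts } s'' m) :
    Exec (scanLoop a b) { s with inp := encodeNum y ++ rest, seen := [], miss := [] } s''
      ((2 * s.name.length + a + b + 15) * (encodeNum y).length + m) := by
  obtain ⟨e₁, e₂, e₃⟩ := foldl_compareStep (nameBits y) s.name [] []
  have hf := foldl_prod_compareStep (nameBits y) s.tmp (s.name, [], [])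
  revert hf e₁ e₂ e₃
  generalize hr : (nameBits y).foldl compareStep (s.name, [], []) = r
  obtain ⟨x, v, f⟩ := r
  intro e₁ e₂ e₃ hf
  dsimp only at *
  simp only [List.reverse_nil, List.nil_append, true_and, List.length_nil, zero_add] at e₁ e₂ e₃
  have hv : v.length ≤ s.name.length := by rw [← e₁]; simp
  set w := if s.name = nameBits y then if s.low = [] then a else b else 0 with hw
  have he := exec_endName
    (p := addPts a b) (q := leaveTop)
    (s := { s with
      inp := rest, tmp := Sym.comma :: ((nameBits y).reverse ++ s.tmp), name := x, seen := v,
      miss := f })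
    (s' := { s with
      inp := rest, tmp := Sym.comma :: ((nameBits y).reverse ++ s.tmp), name := x, seen := v,
      miss := [], low := [Sym.comma], pts := unary w ++ s.pts }) (n := a + b + 4) (by
    split_ifs with hn
    · have hw' : w = if s.low = [] then a else b := by rw [hw, if_pos (e₃.1 hn)]
      rw [hw']
      exact (exec_addPts a b { s with
        inp := rest, tmp := Sym.comma :: ((nameBits y).reverse ++ s.tmp), name := x, seen := v,
        miss := [] } hlow).mono (by omega)
    · have hw' : w = 0 := by rw [hw, if_neg (fun h => hn (e₃.2 h))]
      rw [hw']
      exact (exec_leaveTop { s with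
        inp := rest, tmp := Sym.comma :: ((nameBits y).reverse ++ s.tmp), name := x, seen := v,
        miss := [] } hlow).mono (by omega))
  dsimp only at he
  rw [e₁] at he
  rw [show (encodeNum y).reverse = Sym.comma :: (nameBits y).reverse by simp [encodeNum_eq]] at h
  have hc := Exec.loop_cons (k := .inp) (isEnd := never)
    (body := fun y => push .tmp y ;; scanSym a b y)
    (s := { s with
      inp := Sym.comma :: rest, tmp := (nameBits y).reverse ++ s.tmp, name := x, seen := v,
      miss := f }) (a := Sym.comma) (l := rest) rfl rfl
    ((Exec.push _ _ _).seq he) (s'' := s'') (m := m) h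
  have hp := Exec.loop_prefix (k := .inp) (isEnd := never)
    (body := fun y => push .tmp y ;; scanSym a b y)
    (fun r : List Sym × List Sym × List Sym × List Sym =>
      { s with tmp := r.1, name := r.2.1, seen := r.2.2.1, miss := r.2.2.2 })
    (fun p a => (a :: p.1, compareStep p.2 a)) (fun l _ => ∀ a ∈ l, ∃ β, a = Sym.bit β) 4
    (Sym.comma :: rest)
    (fun z l p hz => ⟨rfl, by
      obtain ⟨β, rfl⟩ := hz z (by simp)
      exact (Exec.push _ _ _).seq (exec_matchSym _ _), fun z hz' => hz z (by simp [hz'])⟩)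
    (nameBits y) (s.tmp, s.name, [], []) (fun z hz => by
      obtain ⟨β, -, rfl⟩ := List.mem_map.1 hz
      exact ⟨β, rfl⟩) (s := s'')
    (m := 1 + (a + b + 4 + 2 * f.length + 2 * v.length + 5) + m + 1)
  rw [hf] at hp
  have := hp hc
  rw [encodeNum_eq, List.append_assoc]
  refine Exec.mono this ?_
  simp only [List.length_append, List.length_cons, List.length_nil, zero_add, mul_add, mul_one]
  have : 7 * (nameBits y).length ≤ (2 * s.name.length + a + b + 15) * (nameBits y).length :=
    Nat.mul_le_mul_right _ (by omega)
  omega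

/-- Both states of `low` are admitted because the induction goes on below the top position; the
semicolon resets the flag for the next vote. -/
theorem exec_scanVote (a b x : ℕ) (l : List ℕ) (s : Store) (hname : s.name = nameBits x)
    (hlow : s.low = [] ∨ s.low = [Sym.comma]) (rest : List Sym) {s'' : Store} {m : ℕ}
    (h : Exec (scanLoop a b) { s with
      inp := rest
      tmp := (encodeNums l).reverse ++ s.tmp
      seen := []
      miss := []
      low := []
      pts := unary (namePts (if s.low = [] then a else b) b x l) ++ s.pts } s'' m) :
    Exec (scanLoop a b) { s with inp := encodeNums l ++ rest, seen := [], miss := [] } s''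
      ((2 * s.name.length + a + b + 15) * (encodeNums l).length + m) := by
  induction l generalizing s with
  | nil =>
    have key : Exec (ifPop .low skip fun _ => skip)
        { s with inp := rest, tmp := Sym.semi :: s.tmp, seen := [], miss := [] }
        { s with inp := rest, tmp := Sym.semi :: s.tmp, seen := [], miss := [], low := [] } 2 := by
      rcases hlow with hl | hl
      · have := Exec.skip { s with inp := rest, tmp := Sym.semi :: s.tmp, seen := [], miss := [] }
        simp only [hl] at this ⊢
        exact Exec.ifPop_nil rfl this
      · exact Exec.ifPop_cons (k := .low)
          (s := { s with inp := rest, tmp := Sym.semi :: s.tmp, seen := [], miss := [] })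
          hl (Exec.skip _)
    refine (Exec.loop_cons (k := .inp) (isEnd := never) (a := Sym.semi) (l := rest) rfl rfl
      ((Exec.push _ _ _).seq key) h).mono ?_
    simp [encodeNums]
  | cons y l ih =>
    have e : encodeNums (y :: l) = encodeNum y ++ encodeNums l := by simp [encodeNums]
    rw [e, List.append_assoc]
    refine (exec_scanName a b s hlow y (encodeNums l ++ rest)
      (ih { s with
        tmp := (encodeNum y).reverse ++ s.tmp, low := [Sym.comma],
        pts := unary (if s.name = nameBits y then if s.low = [] then a else b else 0) ++ s.pts }
        hname (Or.inr rfl) (h |> cast ?_))).mono ?_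
    · simp only [e, List.reverse_append, List.append_assoc, namePts, List.cons_ne_nil, if_false,
        hname, nameBits_inj]
      rw [← List.append_assoc (unary _), unary_append, add_comm]
    · rw [List.length_append]
      ring_nf
      omega

theorem namePts_ofFn {k m b : ℕ} {a : Fin (k + 1) → ℕ} (hb : ∀ j : Fin k, a j.succ = b)
    (v : TopRanking (k + 1) m) (x : Fin m) :
    namePts (a 0) b x (List.ofFn fun j => (v j : ℕ)) = voteScore a v x := by
  have key : ∀ (n : ℕ) (f : Fin n → Fin m),
      namePts b b x (List.ofFn fun j => (f j : ℕ)) = ∑ j, if f j = x then b else 0 := by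
    intro n
    induction n with
    | zero => intro f; simp [namePts]
    | succ n ih =>
      intro f
      rw [List.ofFn_succ, namePts, ih fun j => f j.succ, Fin.sum_univ_succ]
      simp [Fin.ext_iff, eq_comm]
  rw [List.ofFn_succ, namePts, key k fun j => v j.succ, voteScore, Fin.sum_univ_succ]
  simp [Fin.ext_iff, eq_comm, hb]

/-- The known votes as a string. -/
def encodeVotes {ℓ m : ℕ} (P : List (TopRanking ℓ m)) : List Sym :=
  P.flatMap fun v => encodeNums (List.ofFn fun j => (v j : ℕ))

theorem exec_scanLoop {k m b : ℕ} {a : Fin (k + 1) → ℕ} (hb : ∀ j : Fin k, a j.succ = b)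
    (P : List (TopRanking (k + 1) m)) (x : Fin m) (s : Store) (hname : s.name = nameBits x) :
    Exec (scanLoop (a 0) b) { s with inp := encodeVotes P, seen := [], miss := [], low := [] }
      { s with
        inp := []
        tmp := (encodeVotes P).reverse ++ s.tmp
        seen := []
        miss := []
        low := []
        pts := unary (score a P x) ++ s.pts }
      ((2 * s.name.length + a 0 + b + 15) * (encodeVotes P).length + 1) := by
  induction P generalizing s with
  | nil => exact (Exec.loop_nil rfl).mono (by omega)
  | cons v P ih =>
    have e : encodeVotes (v :: P) = encodeNums (List.ofFn fun j => (v j : ℕ)) ++ encodeVotes P := by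
      simp [encodeVotes]
    rw [e]
    refine (exec_scanVote (a 0) b x _ { s with low := [] } hname (Or.inl rfl) (encodeVotes P)
      (m := (2 * s.name.length + a 0 + b + 15) * (encodeVotes P).length + 1)
      (ih { s with
        tmp := (encodeNums (List.ofFn fun j => (v j : ℕ))).reverse ++ s.tmp
        pts := unary (voteScore a v x) ++ s.pts } hname |> cast ?_)).mono ?_
    · rw [score_cons, List.reverse_append]
      simp only [if_true, namePts_ofFn hb, List.append_assoc]
      rw [← List.append_assoc (unary _), unary_append, add_comm (score a P x)]
    · rw [List.length_append]
      ring_nf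
      omega

/-- Add the points of the candidate with the given name in the known votes. -/
def scoreName (a b : ℕ) : Prog Stack Sym := scanLoop a b ;; move .tmp .inp

/-- The votes are put back on `inp`, to be scanned again for the next candidate; this adds 2 steps
per symbol. -/
theorem exec_scoreName {k m b : ℕ} {a : Fin (k + 1) → ℕ} (hb : ∀ j : Fin k, a j.succ = b)
    (P : List (TopRanking (k + 1) m)) (x : Fin m) (s : Store) (hname : s.name = nameBits x) :
    Exec (scoreName (a 0) b)
      { s with inp := encodeVotes P, tmp := [], seen := [], miss := [], low := [] }
      { s with
        inp := encodeVotes P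
        tmp := []
        seen := []
        miss := []
        low := []
        pts := unary (score a P x) ++ s.pts }
      ((2 * s.name.length + a 0 + b + 17) * (encodeVotes P).length + 2) := by
  have := (exec_scanLoop hb P x { s with tmp := [] } hname).seq
    (Exec.move { s with
      inp := []
      tmp := (encodeVotes P).reverse ++ []
      seen := []
      miss := []
      low := []
      pts := unary (score a P x) ++ s.pts } (k := .tmp) (k' := .inp) (by decide))
  simp only [Store.set, Store.get, List.append_nil, List.reverse_reverse, List.length_reverse]
    at this
  refine this.mono ?_
  ring_nf
  omega

/-- Add the handicap of a candidate which precedes the target in the priority list. -/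
def addBonus : Prog Stack Sym := ifPop .past (push .pts Sym.comma) fun z => push .past z

theorem exec_addBonus (s : Store) :
    Exec addBonus s { s with pts := unary (if s.past = [] then 1 else 0) ++ s.pts } 2 := by
  rcases hp : s.past with _ | ⟨z, l⟩
  · have := Exec.ifPop_nil (q := fun z => push .past z) (s := s) (k := .past) hp
      (Exec.push s .pts Sym.comma)
    simp only [Store.set, hp] at this
    exact this
  · have := Exec.ifPop_cons (p := push .pts Sym.comma) (q := fun z => push .past z) (s := s)
      (k := .past) hp (Exec.push _ .past z)
    simp only [Store.set, Store.get] at this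
    simp only [List.cons_ne_nil, if_false]
    exact this

/-! ### Excesses and capacities in unary -/

/-- Subtract the number on the stack `base` from the one on `pts`. -/
def subtractBase : Prog Stack Sym :=
  loop .base never (fun _ => push .aux Sym.comma ;; pops .pts 1) ;; move .aux .base

theorem exec_subtractBase (s : Store) (p B : ℕ) :
    Exec subtractBase { s with pts := unary p, base := unary B, aux := [] }
      { s with pts := unary (p - B), base := unary B, aux := [] } (6 * B + 2) := by
  have key : ∀ n : ℕ, (fun x : ℕ × ℕ => (x.1 + 1, x.2 - 1))^[n] (0, p) = (n, p - n) := by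
    intro n
    induction n with
    | zero => rfl
    | succ n ih =>
      rw [Function.iterate_succ_apply', ih]
      rfl
  have h := Exec.loop_all (k := .base) (isEnd := never)
    (body := fun _ => push .aux Sym.comma ;; pops .pts 1)
    (fun x : ℕ × ℕ => { s with aux := unary x.1, pts := unary x.2 })
    (fun x _ => (x.1 + 1, x.2 - 1)) (fun _ _ => True) 3
    (fun a l x _ => ⟨rfl, by
      have := (Exec.push ({ s with
        aux := unary x.1, pts := unary x.2, base := l }) .aux Sym.comma).seq (Exec.pops _ .pts 1)
      simp only [Store.set, Store.get, List.drop_replicate] at this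
      exact this, trivial⟩) (unary B) (0, p) trivial
  rw [foldl_const, List.length_replicate, key] at h
  have := h.seq (Exec.move _ (k := .aux) (k' := .base) (by decide))
  simp only [Store.set, Store.get, List.append_nil, List.reverse_replicate, List.length_replicate]
    at this
  exact this.mono (by omega)

/-- This recursion replaces division by a loop over the votes: a vote either works off `b` points of
the excess or, once there is none, yields a position. If `0 < e < b`, one vote removes the whole
excess. -/
theorem capacity_succ (b t e : ℕ) :
    capacity b (t + 1) e = (if b = 0 ∨ e = 0 then 1 else 0) + capacity b t (e - b) := by
  rcases Nat.eq_zero_or_pos b with rfl | hb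
  · simp [capacity, add_comm]
  rcases Nat.eq_zero_or_pos e with rfl | he
  · simp [capacity_zero, add_comm]
  rw [if_neg (by omega)]
  unfold capacity
  rcases le_or_gt b e with h | h
  · rw [show e + b - 1 = (e - b + b - 1) + b by omega, Nat.add_div_right _ hb]
    omega
  · rw [show e - b + b - 1 = b - 1 by omega, Nat.div_eq_of_lt (show b - 1 < b by omega),
      show e + b - 1 = (e - 1) + b by omega, Nat.add_div_right _ hb, Nat.div_eq_of_lt (by omega)]
    omega

/-- Use a vote to take `b` points off the excess of the candidate, or note a position to be filled
if there is no excess. -/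
def fillStep (b : ℕ) : Prog Stack Sym :=
  if b = 0 then push .slots Sym.comma
  else ifPop .pts (push .slots Sym.comma) fun _ => pops .pts (b - 1)

theorem exec_fillStep (b : ℕ) (s : Store) (e n : ℕ) :
    Exec (fillStep b) { s with pts := unary e, slots := unary n }
      { s with
        pts := unary (e - b), slots := unary (n + if b = 0 ∨ e = 0 then 1 else 0) } (b + 2) := by
  unfold fillStep
  by_cases hb : b = 0
  · subst hb
    simp only [if_true, true_or]
    exact (Exec.push _ _ _).mono (by omega)
  · simp only [hb, if_false, false_or]
    rcases e with _ | e
    · simp only [if_true, Nat.zero_sub]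
      exact (Exec.ifPop_nil rfl (Exec.push _ _ _)).mono (by omega)
    · simp only [Nat.add_eq_zero_iff, one_ne_zero, and_false, if_false, add_zero]
      have := Exec.ifPop_cons (p := push .slots Sym.comma) (q := fun _ => pops .pts (b - 1))
        (s := { s with pts := unary (e + 1), slots := unary n }) (k := .pts) (a := Sym.comma)
        (l := unary e) rfl (Exec.pops _ .pts (b - 1))
      simp only [Store.set, Store.get, List.drop_replicate] at this
      rw [show e + 1 - b = e - (b - 1) by omega]
      exact this.mono (by omega)

/-- Add the number of votes in which the candidate can fill a position. -/
def fillSlots (b : ℕ) : Prog Stack Sym :=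
  loop .cnt never (fun _ => push .aux Sym.comma ;; fillStep b) ;; move .aux .cnt

/-- The remainder left on `pts` is nonzero exactly when `e > b * t`, which is the failure that
`checkExcess` records. -/
theorem exec_fillSlots (b : ℕ) (s : Store) (e n t : ℕ) :
    Exec (fillSlots b) { s with pts := unary e, slots := unary n, cnt := unary t, aux := [] }
      { s with
        pts := unary (e - b * t), slots := unary (n + capacity b t e), cnt := unary t, aux := [] }
      ((b + 6) * t + 2) := by
  have key : ∀ t i e n : ℕ, (fun x : ℕ × ℕ × ℕ =>
      (x.1 + 1, x.2.1 - b, x.2.2 + if b = 0 ∨ x.2.1 = 0 then 1 else 0))^[t] (i, e, n) =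
        (i + t, e - b * t, n + capacity b t e) := by
    intro t
    induction t with
    | zero => intro i e n; simp [capacity]
    | succ t ih =>
      intro i e n
      rw [Function.iterate_succ_apply, ih, capacity_succ, mul_add, mul_one, Nat.sub_sub,
        add_comm b, add_assoc n, add_assoc i, add_comm 1]
  have h := Exec.loop_all (k := .cnt) (isEnd := never)
    (body := fun _ => push .aux Sym.comma ;; fillStep b)
    (fun x : ℕ × ℕ × ℕ => { s with aux := unary x.1, pts := unary x.2.1, slots := unary x.2.2 })
    (fun x _ => (x.1 + 1, x.2.1 - b, x.2.2 + if b = 0 ∨ x.2.1 = 0 then 1 else 0))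
    (fun _ _ => True) (1 + (b + 2))
    (fun a l x _ => ⟨rfl, (Exec.push _ _ _).seq (exec_fillStep b
      { s with aux := unary (x.1 + 1), cnt := l } x.2.1 x.2.2), trivial⟩)
    (unary t) (0, e, n) trivial
  rw [foldl_const, List.length_replicate, key, zero_add] at h
  have := h.seq (Exec.move _ (k := .aux) (k' := .cnt) (by decide))
  simp only [Store.set, Store.get, List.append_nil, List.reverse_replicate, List.length_replicate]
    at this
  refine this.mono ?_
  ring_nf
  omega

/-- Record a failure if the candidate has excess points left. -/
def checkExcess : Prog Stack Sym :=
  ifPop .pts skip (fun _ => push .fail Sym.comma) ;; clear .pts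

theorem exec_checkExcess (s : Store) (e : ℕ) :
    Exec checkExcess { s with pts := unary e }
      { s with pts := [], fail := if e = 0 then s.fail else Sym.comma :: s.fail } (2 * e + 3) := by
  rcases e with _ | e
  · exact ((Exec.ifPop_nil rfl (Exec.skip _)).seq (Exec.clear _ _)).mono le_rfl
  · have := (Exec.ifPop_cons (p := skip) (q := fun _ => push .fail Sym.comma)
      (s := { s with pts := unary (e + 1) }) (k := .pts) (a := Sym.comma) (l := unary e) rfl
      (Exec.push _ .fail _)).seq (Exec.clear _ .pts)
    simp only [Store.set, Store.get, List.length_replicate] at this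
    exact this.mono (by omega)

/-- The store while the candidates are examined. -/
def candStore {ℓ m : ℕ} (P : List (TopRanking ℓ m)) (c N t B : ℕ) (cand tmp past fail : List Sym)
    (n : ℕ) : Store where
  inp := encodeVotes P
  tmp := tmp
  bound := unary N
  tgt := nameBits c
  cnt := unary t
  cand := cand
  base := unary B
  slots := unary n
  past := past
  fail := fail

/-- Examine a candidate whose name has been read. -/
def examine (a b : ℕ) : Prog Stack Sym :=
  move .tmp .name ;; cmpTarget ;; scoreName a b ;; addBonus ;; clear .name ;; subtractBase ;;
    fillSlots b ;; checkExcess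

/-- The bonus depends on `past'`, after the comparison with the target, so that the target itself
receives none. -/
theorem exec_examine {k m b : ℕ} {a : Fin (k + 1) → ℕ} (hb : ∀ j : Fin k, a j.succ = b)
    (P : List (TopRanking (k + 1) m)) (c N t B : ℕ) (x : Fin m) (cand past past' fail : List Sym)
    (n e : ℕ) (hpast : past' = if (x : ℕ) = c then Sym.comma :: past else past)
    (he : e = score a P x + (if past' = [] then 1 else 0) - B) :
    Exec (examine (a 0) b) (candStore P c N t B cand (nameBits x).reverse past fail n)
      (candStore P c N t B cand [] past' (if e ≤ b * t then fail else Sym.comma :: fail)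
        (n + capacity b t e))
      (6 * (nameBits x).length + 9 * (nameBits c).length +
        (2 * (nameBits x).length + a 0 + b + 17) * (encodeVotes P).length + 6 * B + (b + 6) * t +
        2 * score a P x + 40) := by
  have h₀ := Exec.move (candStore P c N t B cand (nameBits x).reverse past fail n)
    (k := .tmp) (k' := .name) (by decide)
  simp only [candStore, Store.set, Store.get, List.append_nil, List.reverse_reverse,
    List.length_reverse] at h₀
  have h₁ := exec_cmpTarget
    { candStore P c N t B cand [] past fail n with name := nameBits x }
  simp only [candStore, nameBits_inj] at h₁
  rw [← hpast] at h₁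
  have h₂ := exec_scoreName hb P x
    { candStore P c N t B cand [] past' fail n with name := nameBits x } rfl
  simp only [candStore, List.append_nil] at h₂
  have h₃ := exec_addBonus { candStore P c N t B cand [] past' fail n with
    name := nameBits x, pts := unary (score a P x) }
  simp only [candStore, unary_append] at h₃
  have h₄ := Exec.clear { candStore P c N t B cand [] past' fail n with
    name := nameBits x, pts := unary ((if past' = [] then 1 else 0) + score a P x) } .name
  simp only [candStore, Store.set, Store.get] at h₄
  have h₅ := exec_subtractBase (candStore P c N t B cand [] past' fail n)
    ((if past' = [] then 1 else 0) + score a P x) B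
  rw [← show e = (if past' = [] then 1 else 0) + score a P x - B by rw [he, add_comm]] at h₅
  have h₆ := exec_fillSlots b (candStore P c N t B cand [] past' fail n) e n t
  have h₇ := exec_checkExcess
    (candStore P c N t B cand [] past' fail (n + capacity b t e)) (e - b * t)
  simp only [candStore, Nat.sub_eq_zero_iff_le] at h₅ h₆ h₇
  have h := h₀.seq (h₁.seq (h₂.seq (h₃.seq (h₄.seq (h₅.seq (h₆.seq h₇))))))
  refine h.mono ?_
  have : e ≤ score a P x + 1 := by split_ifs at he <;> omega
  omega

/-- Process a symbol of the list of candidates. -/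
def candSym (a b : ℕ) : Sym → Prog Stack Sym
  | .bit β => push .tmp (.bit β)
  | .comma => examine a b
  | .semi => skip

/-- The candidates in a given order as a string. -/
def encodeCands {m : ℕ} (l : List (Fin m)) : List Sym :=
  l.flatMap fun x : Fin m => encodeNum (x : ℕ)

/-- Examine all candidates. -/
def candLoop (a b : ℕ) : Prog Stack Sym := loop .cand never (candSym a b)

/-- The candidates come in order of priority, so `past` is empty just as long as the target is still
ahead; `h₀` and `h₁` are this invariant. Of the final `past'` and `fail'`, the lengths matter only
for the cost of clearing them. `K` bounds the cost of each examination. -/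
theorem exec_candLoop {k m b : ℕ} {a : Fin (k + 1) → ℕ} (hb : ∀ j : Fin k, a j.succ = b)
    (P : List (TopRanking (k + 1) m)) (prio : Fin m ≃ Fin m) (c : Fin m) (N t d K : ℕ)
    (l : List (Fin m)) (hl : l.Pairwise fun x y => prio.symm x < prio.symm y)
    (hK : ∀ x ∈ l, 6 * (nameBits x).length + 9 * (nameBits c).length +
        (2 * (nameBits x).length + a 0 + b + 17) * (encodeVotes P).length +
        6 * (score a P c + t * d) + (b + 6) * t + 2 * score a P x + 40 ≤ K)
    (past fail : List Sym) (n : ℕ) (h₀ : past = [] → c ∈ l)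
    (h₁ : past ≠ [] → ∀ x ∈ l, prio.symm c < prio.symm x) :
    ∃ past' fail', past'.length ≤ past.length + l.length ∧
      fail'.length ≤ fail.length + l.length ∧
      (fail' = [] ↔ fail = [] ∧ ∀ x ∈ l, excess prio c (score a P) d t x ≤ b * t) ∧
      Exec (candLoop (a 0) b)
        (candStore P c N t (score a P c + t * d) (encodeCands l) [] past fail n)
        (candStore P c N t (score a P c + t * d) [] [] past' fail'
          (n + (l.map fun x => capacity b t (excess prio c (score a P) d t x)).sum))
        ((K + 2) * (encodeCands l).length + 1) := by
  induction l generalizing past fail n with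
  | nil =>
    exact ⟨past, fail, by simp, by simp, by simp, (Exec.loop_nil rfl).mono (by omega)⟩
  | cons x l ih =>
    obtain ⟨hx, hl⟩ := List.pairwise_cons.1 hl
    set past₁ := if (x : ℕ) = c then Sym.comma :: past else past with hpast₁
    set e := excess prio c (score a P) d t x with he
    have hbonus : tieBonus prio c x = if past₁ = [] then 1 else 0 := by
      rw [hpast₁]
      by_cases hxc : x = c
      · simp [hxc, tieBonus_self]
      · have hxc' : ¬ (x : ℕ) = c := fun h => hxc (Fin.ext h)
        simp only [if_neg hxc']
        rw [tieBonus]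
        by_cases hp : past = []
        · have : c ∈ l := (List.mem_cons.1 (h₀ hp)).resolve_left (Ne.symm hxc)
          simp [hp, hx c this]
        · simp [hp, (h₁ hp x (by simp)).le]
    set fail₁ := if e ≤ b * t then fail else Sym.comma :: fail with hfail₁
    obtain ⟨past', fail', i₁, i₂, i₃, i₄⟩ := ih hl (fun y hy => hK y (by simp [hy])) past₁ fail₁
      (n + capacity b t e)
      (by
        rw [hpast₁]
        split_ifs with hxc
        · simp
        · intro hp
          exact (List.mem_cons.1 (h₀ hp)).resolve_left fun h => hxc (by rw [h]))
      (by
        rw [hpast₁]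
        split_ifs with hxc
        · intro _ y hy
          rw [← Fin.ext hxc]
          exact hx y hy
        · intro hp y hy
          exact h₁ hp y (by simp [hy]))
    have j₁ : past₁.length ≤ past.length + 1 := by
      rw [hpast₁]
      split_ifs <;> simp
    have j₂ : fail₁.length ≤ fail.length + 1 := by
      rw [hfail₁]
      split_ifs <;> simp
    refine ⟨past', fail', ?_, ?_, ?_, ?_⟩
    · rw [List.length_cons]; omega
    · rw [List.length_cons]; omega
    · rw [i₃, hfail₁, List.forall_mem_cons, ← he]
      split_ifs with h <;> simp [h]
    · have hexam := (exec_examine hb P c N t (score a P c + t * d) x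
        (encodeCands l) past past₁ fail n e hpast₁ (by
          rw [he, excess, hbonus])).mono (hK x (by simp))
      have hc := Exec.loop_cons (k := .cand) (isEnd := never) (body := candSym (a 0) b)
        (a := Sym.comma) (l := encodeCands l)
        (s := candStore P c N t (score a P c + t * d)
          (Sym.comma :: encodeCands l) (nameBits x).reverse past fail n)
        rfl rfl hexam i₄
      have hp := Exec.loop_prefix (k := .cand) (isEnd := never) (body := candSym (a 0) b)
        (fun r : List Sym => candStore P c N t (score a P c + t * d) [] r past fail n)
        (fun r y => y :: r) (fun l _ => ∀ a ∈ l, ∃ β, a = Sym.bit β) 1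
        (Sym.comma :: encodeCands l)
        (fun z l p hz => ⟨rfl, by
          obtain ⟨β, rfl⟩ := hz z (by simp)
          exact Exec.push _ _ _, fun z hz' => hz z (by simp [hz'])⟩)
        (nameBits x) [] (fun z hz => by
          obtain ⟨β, -, rfl⟩ := List.mem_map.1 hz
          exact ⟨β, rfl⟩)
        (m := K + ((K + 2) * (encodeCands l).length + 1) + 1)
        (s := candStore P c N t (score a P c + t * d) [] [] past' fail'
          (n + capacity b t e +
            (l.map fun x => capacity b t (excess prio c (score a P) d t x)).sum))
      have hfold : (nameBits x).foldl (fun r y => y :: r) [] = (nameBits x).reverse := by simp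
      rw [hfold] at hp
      have := hp hc
      rw [show encodeCands (x :: l) = encodeNum (x : ℕ) ++ encodeCands l from List.flatMap_cons,
        encodeNum_eq, List.append_assoc, List.map_cons, List.sum_cons,
        ← add_assoc]
      refine Exec.mono this ?_
      simp only [List.length_append, List.length_cons, List.length_nil, zero_add, mul_add, mul_one]
      have : 2 * (nameBits x).length ≤ (K + 2) * (nameBits x).length :=
        Nat.mul_le_mul_right _ (by omega)
      omega

/-! ### Reading the input and cutting off the number of absent votes -/

/-- Store a multiple of the input length in unary. -/
def initBound (κ : ℕ) : Prog Stack Sym :=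
  loop .inp never (fun y => push .tmp y ;; pushes .bound κ) ;; move .tmp .inp

theorem exec_initBound (κ : ℕ) (w : List Sym) :
    Exec (initBound κ) { inp := w } { inp := w, bound := unary (κ * w.length) }
      ((κ + 5) * w.length + 2) := by
  have key : ∀ (w r : List Sym) (n : ℕ), w.foldl (fun x y => (y :: x.1, κ + x.2)) (r, n) =
      (w.reverse ++ r, κ * w.length + n) := by
    intro w
    induction w with
    | nil => intro r n; simp
    | cons y w ih =>
      intro r n
      rw [List.foldl_cons, ih, List.length_cons]
      simp [mul_add, add_assoc]
  have h := Exec.loop_all (k := .inp) (isEnd := never)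
    (body := fun y => push .tmp y ;; pushes .bound κ)
    (fun x : List Sym × ℕ => { tmp := x.1, bound := unary x.2 })
    (fun x y => (y :: x.1, κ + x.2)) (fun _ _ => True) (1 + (κ + 1))
    (fun a l x _ => ⟨rfl, by
      have := (Exec.push ({ inp := l, tmp := x.1, bound := unary x.2 }) .tmp a).seq
        (Exec.pushes _ .bound κ)
      simp only [Store.set, Store.get, unary_append] at this
      exact this, trivial⟩) w ([], 0) trivial
  rw [key, add_zero, List.append_nil] at h
  have := h.seq (Exec.move _ (k := .tmp) (k' := .inp) (by decide))
  simp only [Store.set, Store.get, List.append_nil, List.reverse_reverse, List.length_reverse]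
    at this
  refine this.mono ?_
  ring_nf
  omega

/-- Read the input up to a end symbol. -/
def readTo (isEnd : Sym → Bool) : Prog Stack Sym := loop .inp isEnd fun y => push .tmp y

theorem exec_readTo {isEnd : Sym → Bool} (s : Store) (u r : List Sym) (y : Sym)
    (hu : ∀ z ∈ u, isEnd z = false) (hy : isEnd y = true) :
    Exec (readTo isEnd) { s with inp := u ++ y :: r, tmp := [] }
      { s with inp := r, tmp := u.reverse } (2 * u.length + 1) := by
  have hfold : u.foldl (fun r y => y :: r) [] = u.reverse := by simp
  have hp := Exec.loop_prefix (k := .inp) (isEnd := isEnd) (body := fun y => push .tmp y)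
    (fun r : List Sym => { s with tmp := r }) (fun r y => y :: r)
    (fun l _ => ∀ a ∈ l, isEnd a = false) 1 (y :: r)
    (fun z l p hz => ⟨hz z (by simp), Exec.push _ _ _, fun z hz' => hz z (by simp [hz'])⟩)
    u [] hu (m := 1) (s := { s with inp := r, tmp := u.reverse })
  rw [hfold] at hp
  exact hp (Exec.loop_end rfl hy)

/-- Double a unary number and add a bit, cutting the result off at the bound. -/
def shiftIn (y : Sym) : Prog Stack Sym :=
  loop .cnt never (fun _ => pushes .aux 2) ;;
  (if y = Sym.bit true then push .aux Sym.comma else skip) ;;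
  loop .bound never (fun _ => push .seen Sym.comma ;;
    ifPop .aux skip fun _ => push .cnt Sym.comma) ;;
  move .seen .bound ;; clear .aux

/-- Transferring at most one unit per symbol of `bound` produces the minimum with `N`; the surplus
on `aux` is discarded. -/
theorem exec_shiftIn (s : Store) (v N : ℕ) (β : Bool) :
    Exec (shiftIn (.bit β))
      { s with cnt := unary v, bound := unary N, aux := [], seen := [] }
      { s with cnt := unary (min (2 * v + β.toNat) N), bound := unary N, aux := [], seen := [] }
      (8 * v + 6 * N + 9) := by
  have key₁ : ∀ n : ℕ, (fun x => 2 + x)^[n] 0 = 2 * n := by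
    intro n
    induction n with
    | zero => rfl
    | succ n ih => rw [Function.iterate_succ_apply', ih]; ring
  have key₂ : ∀ n e : ℕ, (fun x : ℕ × ℕ × ℕ =>
      (x.1 + 1, x.2.1 - 1, if x.2.1 = 0 then x.2.2 else x.2.2 + 1))^[n] (0, e, 0) =
        (n, e - n, min e n) := by
    intro n e
    induction n with
    | zero => simp
    | succ n ih =>
      rw [Function.iterate_succ_apply', ih]
      simp only [Prod.mk.injEq, true_and]
      refine ⟨rfl, ?_⟩
      split_ifs <;> omega
  have h₁ := Exec.loop_all (k := .cnt) (isEnd := never) (body := fun _ => pushes .aux 2)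
    (fun x : ℕ => { s with bound := unary N, aux := unary x, seen := [] })
    (fun x _ => 2 + x) (fun _ _ => True) 3
    (fun a l x _ => ⟨rfl, by
      have := Exec.pushes ({ s with cnt := l, bound := unary N, aux := unary x, seen := [] }) .aux 2
      simp only [Store.set, Store.get, unary_append] at this
      exact this, trivial⟩) (unary v) 0 trivial
  rw [foldl_const, List.length_replicate, key₁] at h₁
  have h₂ : Exec (if Sym.bit β = Sym.bit true then push .aux Sym.comma else skip)
      { s with cnt := [], bound := unary N, aux := unary (2 * v), seen := [] }
      { s with cnt := [], bound := unary N, aux := unary (2 * v + β.toNat), seen := [] } 1 := by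
    cases β
    · exact Exec.skip _
    · exact Exec.push _ _ _
  have h₃ := Exec.loop_all (k := .bound) (isEnd := never)
    (body := fun _ => push .seen Sym.comma ;; ifPop .aux skip fun _ => push .cnt Sym.comma)
    (fun x : ℕ × ℕ × ℕ => { s with seen := unary x.1, aux := unary x.2.1, cnt := unary x.2.2 })
    (fun x _ => (x.1 + 1, x.2.1 - 1, if x.2.1 = 0 then x.2.2 else x.2.2 + 1)) (fun _ _ => True) 3
    (fun a l x _ => ⟨rfl, by
      obtain ⟨i, e, j⟩ := x
      rcases e with _ | e
      · exact (Exec.push _ _ _).seq (Exec.ifPop_nil rfl (Exec.skip _))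
      · exact (Exec.push { s with
            seen := unary i, aux := unary (e + 1), cnt := unary j, bound := l } .seen
            Sym.comma).seq
          (Exec.ifPop_cons (q := fun _ => push .cnt Sym.comma) (k := .aux) (a := Sym.comma) (l := unary e)
            (s := { s with
              seen := unary (i + 1), aux := unary (e + 1), cnt := unary j, bound := l })
            rfl (Exec.push _ .cnt _)), trivial⟩)
    (unary N) (0, 2 * v + β.toNat, 0) trivial
  rw [foldl_const, List.length_replicate, key₂] at h₃
  have h₄ := (Exec.move { s with
      cnt := unary (min (2 * v + β.toNat) N), bound := [], aux := unary (2 * v + β.toNat - N),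
      seen := unary N } (k := .seen) (k' := .bound) (by decide)).seq (Exec.clear _ .aux)
  simp only [Store.set, Store.get, List.append_nil, List.reverse_replicate, List.length_replicate]
    at h₄
  refine (h₁.seq (h₂.seq (h₃.seq h₄))).mono ?_
  have := Bool.toNat_le β
  omega

theorem foldr_encodeNat (n : ℕ) :
    (Computability.encodeNat n).foldr (fun β v => 2 * v + β.toNat) 0 = n := by
  have key : ∀ p : PosNum,
      (Computability.encodePosNum p).foldr (fun β v => 2 * v + β.toNat) 0 = (p : ℕ) := by
    intro p
    induction p with
    | one => rfl
    | bit0 p ih =>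
      rw [Computability.encodePosNum, List.foldr_cons, ih, PosNum.cast_bit0]
      simp [two_mul]
    | bit1 p ih =>
      rw [Computability.encodePosNum, List.foldr_cons, ih, PosNum.cast_bit1]
      simp [two_mul]
  have : ((n : Num) : ℕ) = n := Num.to_of_nat n
  unfold Computability.encodeNat
  rcases hn : (n : Num) with _ | p
  · rw [hn] at this
    exact this
  · rw [hn] at this
    exact (key p).trans this

/-- Cutting off at every step is harmless: once a value reaches `N`, doubling keeps it there. -/
theorem foldr_min (u : List Bool) (N : ℕ) :
    u.foldr (fun β v => min (2 * v + β.toNat) N) 0 =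
      min (u.foldr (fun β v => 2 * v + β.toNat) 0) N := by
  induction u with
  | nil => simp
  | cons β u ih =>
    rw [List.foldr_cons, List.foldr_cons, ih]
    omega

/-- Read the number of absent votes and cut it off at the bound. -/
def readCount : Prog Stack Sym :=
  readTo (fun y => decide (y = Sym.comma)) ;; loop .tmp never shiftIn

theorem nameBits_ne {n : ℕ} {z : Sym} (hz : z ∈ nameBits n) : ∃ β, z = Sym.bit β := by
  obtain ⟨β, -, rfl⟩ := List.mem_map.1 hz
  exact ⟨β, rfl⟩

theorem exec_readCount (s : Store) (t N : ℕ) (r : List Sym) :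
    Exec readCount
      { s with
        inp := encodeNum t ++ r, tmp := [], cnt := [], bound := unary N, aux := [], seen := [] }
      { s with
        inp := r, tmp := [], cnt := unary (min t N), bound := unary N, aux := [], seen := [] }
      ((14 * N + 12) * (nameBits t).length + 2) := by
  have h₁ := exec_readTo (isEnd := fun y => decide (y = Sym.comma))
    { s with cnt := [], bound := unary N, aux := [], seen := [] } (nameBits t) r Sym.comma
    (fun z hz => by obtain ⟨β, rfl⟩ := nameBits_ne hz; rfl) rfl
  have h₂ := Exec.loop_all (k := .tmp) (isEnd := never) (body := shiftIn)
    (fun v : ℕ => { s with inp := r, cnt := unary v, bound := unary N, aux := [], seen := [] })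
    (fun v y => min (2 * v + (decide (y = Sym.bit true)).toNat) N)
    -- Here `v ≤ N` turns the cost `8 * v + 6 * N + 9` of a shift into a uniform one.
    (fun l v => v ≤ N ∧ ∀ z ∈ l, ∃ β, z = Sym.bit β) (14 * N + 9)
    (fun z l v hv => ⟨rfl, by
      obtain ⟨β, rfl⟩ := hv.2 z (by simp)
      have := (exec_shiftIn { s with inp := r, tmp := l } v N β).mono (m := 14 * N + 9) (by omega)
      cases β <;> exact this, min_le_right _ _, fun z hz => hv.2 z (by simp [hz])⟩)
    (nameBits t).reverse 0 ⟨Nat.zero_le _, fun z hz => nameBits_ne (by simpa using hz)⟩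
  -- The code has its least significant bit first; reading it onto `tmp` reverses it, so Horner's
  -- scheme starts with the most significant bit.
  have key : (nameBits t).reverse.foldl
      (fun v y => min (2 * v + (decide (y = Sym.bit true)).toNat) N) 0 = min t N := by
    rw [List.foldl_reverse, nameBits, List.foldr_map]
    have := foldr_min (Computability.encodeNat t) N
    rw [foldr_encodeNat] at this
    rw [← this]
    congr 1
    funext β v
    cases β <;> simp
  rw [key] at h₂
  rw [encodeNum_eq, List.append_assoc]
  refine (h₁.seq h₂).mono ?_
  simp only [List.length_reverse]
  ring_nf
  omega

theorem exec_loop_pushes (k k' : Stack) (hk : k' ≠ k) (w : ℕ) (s : Store) (n v : ℕ) :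
    Exec (loop k never fun _ => pushes k' w) ((s.set k' (unary v)).set k (unary n))
      ((s.set k' (unary (w * n + v))).set k []) ((w + 2) * n + 1) := by
  have key : ∀ n : ℕ, (fun x => w + x)^[n] v = w * n + v := by
    intro n
    induction n with
    | zero => simp
    | succ n ih => rw [Function.iterate_succ_apply', ih]; ring
  have h := Exec.loop_all (k := k) (isEnd := never) (body := fun _ => pushes k' w)
    (fun x : ℕ => s.set k' (unary x)) (fun x _ => w + x) (fun _ _ => True) (w + 1)
    (fun a l x _ => ⟨rfl, by
      have := Exec.pushes ((s.set k' (unary x)).set k l) k' w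
      rwa [Store.get_set_of_ne _ hk, Store.get_set, unary_append, Store.set_comm _ hk,
        Store.set_set] at this, trivial⟩) (unary n) v trivial
  rwa [foldl_const, List.length_replicate, key] at h

theorem exec_loop_pops (k k' : Stack) (hk : k' ≠ k) (s : Store) (n v : ℕ) :
    Exec (loop k never fun _ => pops k' 1) ((s.set k' (unary v)).set k (unary n))
      ((s.set k' (unary (v - n))).set k []) (3 * n + 1) := by
  have key : ∀ n : ℕ, (fun x => x - 1)^[n] v = v - n := by
    intro n
    induction n with
    | zero => simp
    | succ n ih => rw [Function.iterate_succ_apply', ih]; rfl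
  have h := Exec.loop_all (k := k) (isEnd := never) (body := fun _ => pops k' 1)
    (fun x : ℕ => s.set k' (unary x)) (fun x _ => x - 1) (fun _ _ => True) 2
    (fun a l x _ => ⟨rfl, by
      have := Exec.pops ((s.set k' (unary x)).set k l) k' 1
      rwa [Store.get_set_of_ne _ hk, Store.get_set, List.drop_replicate, Store.set_comm _ hk,
        Store.set_set] at this, trivial⟩) (unary n) v trivial
  rwa [foldl_const, List.length_replicate, key] at h

/-- Compute the score of the target candidate, raised by `d` points for each absent vote. -/
def computeBase (a b d : ℕ) : Prog Stack Sym :=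
  move .tgt .tmp ;; loop .tmp never (fun y => push .tgt y ;; push .name y) ;; scoreName a b ;;
    (move .pts .base ;; clear .name) ;;
    loop .cnt never (fun _ => push .aux Sym.comma ;; pushes .base d) ;; move .aux .cnt

theorem exec_computeBase {k m b : ℕ} {a : Fin (k + 1) → ℕ} (hb : ∀ j : Fin k, a j.succ = b)
    (P : List (TopRanking (k + 1) m)) (c : Fin m) (N t d : ℕ) (cand : List Sym) :
    Exec (computeBase (a 0) b d) (candStore P c N t 0 cand [] [] [] 0)
      (candStore P c N t (score a P c + t * d) cand [] [] [] 0)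
      (7 * (nameBits c).length +
        (2 * (nameBits c).length + a 0 + b + 17) * (encodeVotes P).length +
        2 * score a P c + (d + 5) * t + 10) := by
  have h₀ := Exec.move (candStore P c N t 0 cand [] [] [] 0) (k := .tgt) (k' := .tmp) (by decide)
  simp only [candStore, Store.set, Store.get, List.append_nil] at h₀
  have h₁ := Exec.loop_all (k := .tmp) (isEnd := never)
    (body := fun y => push .tgt y ;; push .name y)
    (fun x : List Sym => { candStore P c N t 0 cand [] [] [] 0 with tgt := x, name := x })
    (fun x y => y :: x) (fun _ _ => True) 2
    (fun a l x _ => ⟨rfl, (Exec.push _ _ _).seq (Exec.push _ _ _), trivial⟩)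
    (nameBits c).reverse [] trivial
  have hfold : (nameBits c).reverse.foldl (fun r y => y :: r) [] = nameBits c := by simp
  rw [hfold] at h₁
  simp only [candStore, Store.set] at h₁
  have h₂ := exec_scoreName hb P c
    { candStore P c N t 0 cand [] [] [] 0 with name := nameBits c } rfl
  simp only [candStore, List.append_nil] at h₂
  have h₃ := (Exec.move { candStore P c N t 0 cand [] [] [] 0 with
    name := nameBits c, pts := unary (score a P c) } (k := .pts) (k' := .base) (by decide)).seq
    (Exec.clear _ .name)
  simp only [candStore, Store.set, Store.get, List.reverse_replicate, List.length_replicate,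
    unary_append, add_zero] at h₃
  have key : ∀ n : ℕ, (fun x : ℕ × ℕ => (x.1 + 1, d + x.2))^[n] (0, score a P c) =
      (n, score a P c + n * d) := by
    intro n
    induction n with
    | zero => simp
    | succ n ih =>
      rw [Function.iterate_succ_apply', ih, Prod.mk.injEq]
      exact ⟨rfl, by ring⟩
  have h₄ := Exec.loop_all (k := .cnt) (isEnd := never)
    (body := fun _ => push .aux Sym.comma ;; pushes .base d)
    (fun x : ℕ × ℕ => { candStore P c N t x.2 cand [] [] [] 0 with aux := unary x.1 })
    (fun x _ => (x.1 + 1, d + x.2)) (fun _ _ => True) (d + 2)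
    (fun a l x _ => ⟨rfl, by
      have := (Exec.push ({ candStore P c N t x.2 cand [] [] [] 0 with
        aux := unary x.1, cnt := l }) .aux Sym.comma).seq (Exec.pushes _ .base d)
      simp only [candStore, Store.set, Store.get, unary_append] at this
      exact this.mono (by omega), trivial⟩) (unary t) (0, score a P c) trivial
  rw [foldl_const, List.length_replicate, key] at h₄
  have h₅ := Exec.move { candStore P c N 0 (score a P c + t * d) cand [] [] [] 0 with
    aux := unary t } (k := .aux) (k' := .cnt) (by decide)
  simp only [candStore, Store.set, Store.get, List.reverse_replicate, List.length_replicate,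
    unary_append, add_zero] at h₄ h₅
  refine (h₀.seq (h₁.seq (h₂.seq (h₃.seq (h₄.seq h₅))))).mono ?_
  simp only [List.length_reverse, add_mul]
  omega

/-- Compare the number of positions to be filled with the number of those that can be filled,
empty all stacks, and write the answer. -/
def finish (ℓ : ℕ) : Prog Stack Sym :=
  loop .cnt never (fun _ => pushes .aux ℓ) ;; loop .slots never (fun _ => pops .aux 1) ;;
    ifPop .aux skip (fun _ => push .fail Sym.comma) ;;
    (clear .aux ;; clear .inp ;; clear .bound ;; clear .tgt ;; clear .base ;; clear .past) ;;
    ifPop .fail (push .out (Sym.bit true)) (fun _ => clear .fail ;; push .out (Sym.bit false))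

/-- Truncated subtraction of `n` from `r * t` leaves `aux` empty exactly when there are enough
positions. The other stacks are emptied because the machine must halt with nothing but the answer.
-/
theorem exec_finish {ℓ m : ℕ} (P : List (TopRanking ℓ m)) (c N t B n r : ℕ)
    (past fail : List Sym) :
    Exec (finish r) (candStore P c N t B [] [] past fail n)
      { out := [Sym.bit (decide (fail = [] ∧ t * r ≤ n))] }
      (3 * (r + 2) * t + 3 * n + 2 * (encodeVotes P).length + 2 * N + 2 * (nameBits c).length +
        2 * B + 2 * past.length + 2 * fail.length + 20) := by
  have h₁ := exec_loop_pushes .cnt .aux (by decide) r (candStore P c N t B [] [] past fail n) t 0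
  have h₂ := exec_loop_pops .slots .aux (by decide)
    ((candStore P c N t B [] [] past fail n).set .cnt []) n (r * t)
  have h₃ : Exec (ifPop .aux skip (fun _ => push .fail Sym.comma))
      { candStore P c N 0 B [] [] past fail 0 with aux := unary (r * t - n) }
      { candStore P c N 0 B [] [] past
          (if t * r ≤ n then fail else Sym.comma :: fail) 0 with aux := unary (r * t - n - 1) }
      2 := by
    rw [mul_comm t]
    rcases h : r * t - n with _ | e
    · rw [if_pos (by omega)]
      exact Exec.ifPop_nil rfl (Exec.skip _)
    · rw [if_neg (by omega)]
      exact Exec.ifPop_cons (q := fun _ => push .fail Sym.comma) (k := .aux) (a := Sym.comma) (l := unary e)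
        (s := { candStore P c N 0 B [] [] past fail 0 with aux := unary (e + 1) })
        rfl (Exec.push _ _ _)
  set fail' := if t * r ≤ n then fail else Sym.comma :: fail with hfail'
  have h₄ := (Exec.clear { candStore P c N 0 B [] [] past fail' 0 with
      aux := unary (r * t - n - 1) } .aux).seq ((Exec.clear _ .inp).seq ((Exec.clear _ .bound).seq
    ((Exec.clear _ .tgt).seq ((Exec.clear _ .base).seq (Exec.clear _ .past)))))
  simp only [candStore, Store.set, Store.get, List.length_replicate] at h₄
  have h₅ : Exec (ifPop .fail (push .out (Sym.bit true))
      (fun _ => clear .fail ;; push .out (Sym.bit false)))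
      { fail := fail' } { out := [Sym.bit (decide (fail = [] ∧ t * r ≤ n))] }
      (2 * fail'.length + 3) := by
    have : (fail = [] ∧ t * r ≤ n) ↔ fail' = [] := by
      rw [hfail']
      split_ifs with h <;> simp [h]
    simp only [this]
    rcases fail' with _ | ⟨z, l⟩
    · exact (Exec.ifPop_nil rfl (Exec.push _ _ _)).mono (by simp)
    · refine (Exec.ifPop_cons (q := fun _ => clear .fail ;; push .out (Sym.bit false)) (s := { fail := z :: l }) (k := .fail) (a := z) (l := l) rfl
        ((Exec.clear _ _).seq (Exec.push _ _ _))).mono ?_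
      simp only [Store.set, Store.get, List.length_cons]
      omega
  have hlen : fail'.length ≤ fail.length + 1 := by
    rw [hfail']
    split_ifs <;> simp
  refine (h₁.seq (h₂.seq (h₃.seq (h₄.seq h₅)))).mono ?_
  have : 3 * (r + 2) * t = 3 * (r * t) + 6 * t := by ring
  rw [this, add_mul]
  omega

/-! ### Correctness and running time of the decision program -/

theorem encode_eq {ℓ : ℕ} (I : Instance ℓ) :
    encode I = nameBits I.target ++ Sym.comma :: (encodeNum I.t ++
      (encodeCands (List.ofFn I.prio) ++ Sym.semi :: encodeVotes I.known)) := by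
  have : (List.ofFn fun i => (I.prio i : ℕ)) = (List.ofFn I.prio).map fun x : Fin I.m => (x : ℕ) := by
    rw [List.map_ofFn]
    rfl
  rw [encode, this]
  simp only [encodeNum_eq, encodeNums, encodeCands, encodeVotes, List.flatMap_map,
    List.append_assoc, List.cons_append, List.nil_append]

theorem length_le_length_encodeCands {m : ℕ} (l : List (Fin m)) :
    l.length ≤ (encodeCands l).length := by
  induction l with
  | nil => simp
  | cons x l ih =>
    simp only [encodeCands, List.flatMap_cons, List.length_append, List.length_cons, encodeNum_eq]
      at *
    omega

theorem length_nameBits_le {m : ℕ} {l : List (Fin m)} {x : Fin m} (hx : x ∈ l) :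
    (nameBits x).length ≤ (encodeCands l).length := by
  induction l with
  | nil => simp at hx
  | cons y l ih =>
    simp only [encodeCands, List.flatMap_cons, List.length_append, encodeNum_eq] at *
    rcases List.mem_cons.1 hx with rfl | h
    · omega
    · have := ih h
      omega

theorem length_le_length_encodeVotes {ℓ m : ℕ} (P : List (TopRanking ℓ m)) :
    P.length ≤ (encodeVotes P).length := by
  induction P with
  | nil => simp
  | cons v P ih =>
    simp only [encodeVotes, List.flatMap_cons, List.length_append, List.length_cons, encodeNums,
      List.length_nil] at *
    omega

/-- The decision program. -/
def decideProg (a b d r κ : ℕ) : Prog Stack Sym :=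
  initBound κ ;;
  readTo (fun y => decide (y = Sym.comma)) ;; move .tmp .tgt ;;
  readCount ;;
  readTo (fun y => decide (y = Sym.semi)) ;; move .tmp .cand ;;
  computeBase a b d ;; candLoop a b ;; finish r

theorem exec_decideProg {k b d κ : ℕ} {a : Fin (k + 1) → ℕ} (hb : ∀ j : Fin k, a j.succ = b)
    (hd : a 0 = b + d) (hκ : ∑ j, a j + 1 ≤ κ) (hκa : a 0 ≤ κ) (hκk : k + 1 ≤ κ)
    (I : Instance (k + 1)) :
    ∃ z, (z = Sym.bit true ↔ IsYes a I) ∧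
      Exec (decideProg (a 0) b d (k + 1) κ) { inp := encode I } { out := [z] }
        (300 * (κ * ((encode I).length + 1)) ^ 3) := by
  rw [isYes_iff hb hd]
  have hlen := congrArg List.length (encode_eq I)
  have hw := encode_eq I
  obtain ⟨m, prio, P, t, c⟩ := I
  dsimp only at *
  set w := encode (⟨m, prio, P, t, c⟩ : Instance (k + 1)) with hw'
  set N := κ * w.length with hN
  set G := κ * (w.length + 1) with hG
  set l := List.ofFn prio with hl
  have hmem : ∀ x, x ∈ l := fun x => by
    rw [hl, List.mem_ofFn]
    exact prio.surjective x
  have hll : l.length = m := by rw [hl, List.length_ofFn]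
  simp only [List.length_append, List.length_cons, encodeNum_eq, List.length_nil] at hlen
  have s₁ := length_le_length_encodeCands l
  have s₂ := length_le_length_encodeVotes P
  rw [hll] at s₁
  have s₃ : ∀ x : Fin m, (nameBits x).length ≤ (encodeCands l).length := fun x =>
    length_nameBits_le (hmem x)
  have hA : ∀ j, a j ≤ κ := fun j => by
    refine Fin.cases hκa (fun i => ?_) j
    rw [hb]
    omega
  -- Every known vote distributes `∑ j, a j` points, and every vote and every candidate takes up at
  -- least one input symbol.
  have hsum : ∑ x, (score a P x + 1) ≤ N := by
    rw [Finset.sum_add_distrib, sum_score, Finset.sum_const, Finset.card_univ, Fintype.card_fin,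
      smul_eq_mul, mul_one, hN, mul_comm κ]
    calc P.length * ∑ j, a j + m ≤ P.length * κ + m * κ :=
          add_le_add (Nat.mul_le_mul_left _ (by omega)) (Nat.le_mul_of_pos_right _ (by omega))
      _ = (P.length + m) * κ := by ring
      _ ≤ w.length * κ := Nat.mul_le_mul_right _ (by omega)
  have hmin := feasible_min_iff prio c (score a P) (ℓ := k + 1) (b := b) (d := d) (t := t)
    (fun hb₀ hd₀ x => by
      have hz : ∀ j, a j ≤ 0 := fun j => by
        refine Fin.cases (by omega) (fun i => ?_) j
        rw [hb]
        omega
      simpa using score_le hz P x) hsum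
  rw [← hmin]
  -- From here on every quantity is bounded by `G` or `G * G`, where `G = κ * (w.length + 1)`.
  set T := min t N
  have g₀ : N ≤ G := Nat.mul_le_mul_left _ (by omega)
  have g₁ : w.length + 1 ≤ G := Nat.le_mul_of_pos_left _ (by omega)
  have g₂ : κ ≤ G := Nat.le_mul_of_pos_right _ (by omega)
  have g₃ : T ≤ G := (min_le_right _ _).trans g₀
  have g₄ : ∀ x, score a P x ≤ G := fun x =>
    (score_le hA P x).trans ((Nat.mul_le_mul_right _ (by omega : P.length ≤ w.length)).trans
      (by rw [mul_comm]; exact g₀))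
  have g₅ : ∀ x : Fin m, (nameBits x).length ≤ G := fun x => (s₃ x).trans (by omega)
  have g₆ : (encodeVotes P).length ≤ G := by omega
  have g₇ : d ≤ G := by omega
  have g₈ : b ≤ G := by omega
  have g₉ : a 0 ≤ G := by omega
  have g₁₀ : m ≤ G := by omega
  have g₁₁ : k + 1 ≤ G := by omega
  have g₁₂ : (nameBits t).length ≤ G := by omega
  have g₁₃ : (encodeCands l).length ≤ G := by omega
  have p₁ : 1 ≤ G := by omega
  have p₂ : G ≤ G * G := Nat.le_mul_of_pos_left _ p₁
  have p₃ : G * G ≤ G * G * G := Nat.le_mul_of_pos_right _ p₁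
  have r₁ : (2 * G + G + G + 17) * G = 4 * (G * G) + 17 * G := by ring
  have r₂ : ∀ i, (G + i) * G = G * G + i * G := fun i => by ring
  have h₁ := (exec_initBound κ w).mono (m := 8 * (G * G)) (by
    have : κ * w.length ≤ G * G := Nat.mul_le_mul g₂ (by omega)
    rw [add_mul]
    omega)
  have h₂ := exec_readTo (isEnd := fun y => decide (y = Sym.comma))
    { bound := unary N } (nameBits c) (encodeNum t ++ (encodeCands l ++ Sym.semi :: encodeVotes P))
    Sym.comma (fun z hz => by obtain ⟨β, rfl⟩ := nameBits_ne hz; rfl) rfl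
  rw [← hw] at h₂
  have h₃ := Exec.move {
    inp := encodeNum t ++ (encodeCands l ++ Sym.semi :: encodeVotes P)
    bound := unary N
    tmp := (nameBits c).reverse } (k := .tmp) (k' := .tgt) (by decide)
  simp only [Store.set, Store.get, List.append_nil, List.reverse_reverse, List.length_reverse]
    at h₃
  have h₄ := (exec_readCount { tgt := nameBits c } t N
    (encodeCands l ++ Sym.semi :: encodeVotes P)).mono (m := 28 * (G * G)) (by
    have : (14 * N + 12) * (nameBits t).length ≤ (14 * G + 12 * G) * G :=
      Nat.mul_le_mul (by omega) g₁₂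
    rw [← add_mul, mul_assoc] at this
    omega)
  have h₅ := exec_readTo (isEnd := fun y => decide (y = Sym.semi))
    { bound := unary N, tgt := nameBits c, cnt := unary T } (encodeCands l) (encodeVotes P)
    Sym.semi (fun z hz => by
      obtain ⟨x, -, hx⟩ := List.mem_flatMap.1 hz
      rw [encodeNum_eq, List.mem_append] at hx
      rcases hx with hx | hx
      · obtain ⟨β, rfl⟩ := nameBits_ne hx
        rfl
      · rw [List.mem_singleton.1 hx]
        rfl) rfl
  have h₆ := Exec.move {
    inp := encodeVotes P
    bound := unary N
    tgt := nameBits c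
    cnt := unary T
    tmp := (encodeCands l).reverse } (k := .tmp) (k' := .cand) (by decide)
  simp only [Store.set, Store.get, List.append_nil, List.reverse_reverse, List.length_reverse]
    at h₆
  have h₇ := (exec_computeBase hb P c N T d (encodeCands l)).mono (m := 46 * (G * G)) (by
    calc _ ≤ 7 * G + (2 * G + G + G + 17) * G + 2 * G + (G + 5) * G + 10 := by
          gcongr
          · exact g₅ c
          · exact g₅ c
          · exact g₄ c
      _ ≤ 46 * (G * G) := by rw [r₁, r₂]; omega)
  obtain ⟨past, fail, i₁, i₂, i₃, h₈⟩ := exec_candLoop hb P prio c N T d (97 * (G * G)) l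
    (by
      rw [hl, List.pairwise_ofFn]
      intro i j hij
      simpa using hij)
    (fun x _ => by
      calc _ ≤ 6 * G + 9 * G + (2 * G + G + G + 17) * G + 6 * (G + G * G) + (G + 6) * G + 2 * G +
            40 := by
            gcongr
            · exact g₅ x
            · exact g₅ c
            · exact g₅ x
            · exact g₄ c
            · exact g₄ x
        _ ≤ 97 * (G * G) := by rw [r₁, r₂]; omega)
    [] [] 0 (fun _ => hmem c) (fun h => absurd rfl h)
  set n := 0 + (l.map fun x => capacity b T (excess prio c (score a P) d T x)).sum with hn
  -- The priority list contains each candidate once, so summing along it is summing over all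
  -- candidates.
  have hn' : n = ∑ x, capacity b T (excess prio c (score a P) d T x) := by
    rw [hn, zero_add, hl, List.map_ofFn, List.sum_ofFn]
    exact Equiv.sum_comp prio fun x => capacity b T (excess prio c (score a P) d T x)
  have hnG : n ≤ G * G := by
    rw [hn']
    calc _ ≤ ∑ _x : Fin m, T := Finset.sum_le_sum fun x _ => Nat.sub_le _ _
      _ = m * T := by simp
      _ ≤ G * G := Nat.mul_le_mul g₁₀ g₃
  rw [hll, List.length_nil, zero_add] at i₁ i₂
  have h₉ := (exec_finish P c N T (score a P c + T * d) n (k + 1) past fail).mono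
    (m := 50 * (G * G)) (by
    calc _ ≤ 3 * (G + 2) * G + 3 * (G * G) + 2 * G + 2 * G + 2 * G + 2 * (G + G * G) + 2 * G +
          2 * G + 20 := by
          gcongr
          · exact g₅ c
          · exact g₄ c
          · omega
          · omega
      _ ≤ 50 * (G * G) := by rw [mul_assoc, r₂]; omega)
  rw [← hN] at h₁
  refine ⟨Sym.bit (decide (fail = [] ∧ T * (k + 1) ≤ n)), ?_,
    (h₁.seq (h₂.seq (h₃.seq (h₄.seq (h₅.seq (h₆.seq (h₇.seq (h₈.seq h₉)))))))).mono ?_⟩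
  · rw [Sym.bit.injEq, decide_eq_true_iff, i₃, hn']
    simp [Feasible, hmem]
  -- Only the loop over the candidates is cubic; all other phases are bounded by a multiple of `G *
  -- G`.
  · have q₁ : (97 * (G * G) + 2) * (encodeCands l).length ≤ 97 * (G * G * G) + 2 * G := by
      calc _ ≤ (97 * (G * G) + 2) * G := Nat.mul_le_mul_left _ g₁₃
        _ = _ := by ring
    have q₂ : G ^ 3 = G * G * G := by ring
    have q₃ := g₅ c
    rw [q₂]
    omega

end WAV

open WAV StackProgram in
theorem theorem7 (ℓ : ℕ) (hℓ : 2 ≤ ℓ) (a : Fin ℓ → ℕ) (ha : Antitone a)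
    (htail : ∀ i j : Fin ℓ, 1 ≤ (i : ℕ) → 1 ≤ (j : ℕ) → a i = a j) :
    WAV.DecidableInPolyTime (WAV.encode (ℓ := ℓ)) (WAV.IsYes a) := by
  obtain ⟨k, rfl⟩ := Nat.exists_eq_add_of_le' (show 1 ≤ ℓ by omega)
  have hb : ∀ j : Fin k, a j.succ = a ⟨1, hℓ⟩ := fun j => htail _ _ (by simp) le_rfl
  -- Monotonicity makes the advantage `d` of the top position a natural number.
  obtain ⟨d, hd⟩ := Nat.exists_eq_add_of_le (ha (Fin.zero_le ⟨1, hℓ⟩))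
  -- A constant of the rule, large enough for all three bounds required of `κ`.
  set κ := ∑ j, a j + 1 + a 0 + (k + 1)
  refine decidableInPolyTime_of_runs (decideProg (a 0) (a ⟨1, hℓ⟩) d (k + 1) κ) .inp .out
    (fun y => decide (y = Sym.bit true))
    (Polynomial.C 300 * (Polynomial.C κ * (Polynomial.X + 1)) ^ 3) fun I => ?_
  obtain ⟨z, hz, h⟩ := exec_decideProg hb hd (κ := κ) (by omega) (by omega) (by omega) I
  refine ⟨z, by simpa using hz, ?_⟩
  have hempty : (fun _ => []) = ({} : Store).get := by
    funext k
    cases k <;> rfl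
  rw [hempty, Store.update_get, Store.update_get]
  simp only [Polynomial.eval_mul, Polynomial.eval_pow, Polynomial.eval_add, Polynomial.eval_C,
    Polynomial.eval_X, Polynomial.eval_one]
  exact h
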